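/- Let $\mathbb{T}=\mathbb{R}/\mathbb{Z}$, $0<\alpha\le 2$, $j\in\mathbb{R}\setminus\{0\}$, $V,G\in C^2(\mathbb{T})$, and suppose that $$\text{(a)}\quad \int_{\mathbb{T}^2} G(x-y)f(x)f(y)\,dx\,dy\ge 0\ \text{ for all } f\in C(\mathbb{T}),\qquad \text{(b)}\quad \int_{\mathbb{T}}G(y)\,dy>0 .$$ For a kernel $K\in C^2(\mathbb{T})$ consider the system, with unknowns $m\in C^2(\mathbb{T})$ and $\overline H\in\mathbb{R}$, $$(S_K)\qquad \frac{j^2}{2m(x)^{\alpha}}+V(x)=\int_{\mathbb{T}}K(x-y)m(y)\,dy+\overline H\quad (x\in\mathbb{T}),\qquad m>0,\qquad \int_{\mathbb{T}}m(x)\,dx=1 .$$ Then there is a sequence of trigonometric polynomials $(G_n)_{n\in\mathbb{N}}$, namely the Cesàro (Fejér) means $G_n=\frac1{n+1}\sum_{k=0}^n S_k$ of the partial sums $S_k$ of the Fourier series of $G$, such that (i) every $G_n$ satisfies (a) and (b); (ii) $\lim_{n\to\infty}\|G-G_n\|_{C^2(\mathbb{T})}=0$. Moreover, for every $n$ the system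 $(S_{G_n})$ has a unique solution $(m_n,\overline H_n)\in C^2(\mathbb{T})\times\mathbb{R}$, and there exists $(m,\overline H)\in C^2(\mathbb{T})\times\mathbb{R}$ such that $$\lim_{n\to\infty}\|m-m_n\|_{C^2(\mathbb{T})}=0,\qquad \lim_{n\to\infty}(\overline H-\overline H_n)=0,$$ and $(m,\overline H)$ is the unique solution in $C^2(\mathbb{T})\times\mathbb{R}$ of $(S_G)$. -/

import Mathlib

open Filter Topology

/-- `f ∈ C²(𝕋)`, where `𝕋 = ℝ/ℤ`: functions on the torus are identified with `1`-periodic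
functions on `ℝ`, and integrals over `𝕋` with integrals over `[0, 1]`. -/
structure IsC2Torus (f : ℝ → ℝ) : Prop where
  contDiff : ContDiff ℝ 2 f
  periodic : Function.Periodic f 1

/-- The norm `‖f‖_{C²(𝕋)} = sup |f| + sup |f'| + sup |f''|` (meant for `f ∈ C²(𝕋)`, for which the
three suprema are finite). -/
noncomputable def c2Norm (f : ℝ → ℝ) : ℝ :=
  (⨆ x : ℝ, |f x|) + (⨆ x : ℝ, |deriv f x|) + ⨆ x : ℝ, |deriv (deriv f) x|

/-- The kernel `G` is monotone: `∫_{𝕋²} G(x - y) f(x) f(y) dx dy ≥ 0` for all `f ∈ C(𝕋)`. -/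
def IsMonotoneKernel (G : ℝ → ℝ) : Prop :=
  ∀ f : ℝ → ℝ, Continuous f → Function.Periodic f 1 →
    0 ≤ ∫ x in (0 : ℝ)..1, ∫ y in (0 : ℝ)..1, G (x - y) * f x * f y

/-- The kernel `G` has positive weight: `∫_𝕋 G(y) dy > 0`. -/
def HasPositiveWeight (G : ℝ → ℝ) : Prop :=
  0 < ∫ y in (0 : ℝ)..1, G y

/-- The trigonometric sum `p₀ + ∑_{k=1}^n (p_k cos(2πkx) + q_k sin(2πkx))`. -/
noncomputable def trigSum (n : ℕ) (p q : ℕ → ℝ) (x : ℝ) : ℝ :=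
  p 0 + ∑ k ∈ Finset.Icc 1 n,
    (p k * Real.cos (2 * Real.pi * k * x) + q k * Real.sin (2 * Real.pi * k * x))

/-- `f` is a (real, `1`-periodic) trigonometric polynomial. -/
def IsTrigPolynomial (f : ℝ → ℝ) : Prop :=
  ∃ (n : ℕ) (p q : ℕ → ℝ), f = trigSum n p q

/-- The cosine Fourier coefficients: `p₀ = ∫_𝕋 f` and `p_k = 2 ∫_𝕋 f(x) cos(2πkx) dx`, `k ≥ 1`. -/
noncomputable def cosCoeff (f : ℝ → ℝ) (k : ℕ) : ℝ :=
  if k = 0 then ∫ x in (0 : ℝ)..1, f x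
  else 2 * ∫ x in (0 : ℝ)..1, f x * Real.cos (2 * Real.pi * k * x)

/-- The sine Fourier coefficients `q_k = 2 ∫_𝕋 f(x) sin(2πkx) dx`. -/
noncomputable def sinCoeff (f : ℝ → ℝ) (k : ℕ) : ℝ :=
  2 * ∫ x in (0 : ℝ)..1, f x * Real.sin (2 * Real.pi * k * x)

/-- The `n`-th Cesàro (Fejér) mean `(S_0 + ⋯ + S_n) / (n + 1)` of the partial sums `S_k` of the
Fourier series of `f`. -/
noncomputable def cesaroMean (f : ℝ → ℝ) (n : ℕ) (x : ℝ) : ℝ :=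
  (∑ k ∈ Finset.range (n + 1), trigSum k (cosCoeff f) (sinCoeff f) x) / ((n : ℝ) + 1)

/-- `(m, H) ∈ C²(𝕋) × ℝ` is a smooth solution of the current formulation of the stationary
mean-field game with congestion exponent `α`, current `j`, potential `V` and kernel `G`. -/
structure IsSolution (α j : ℝ) (V G m : ℝ → ℝ) (H : ℝ) : Prop where
  smooth : IsC2Torus m
  pos : ∀ x, 0 < m x
  mass : ∫ x in (0 : ℝ)..1, m x = 1
  eqn : ∀ x, j ^ 2 / (2 * (m x) ^ α) + V x = (∫ y in (0 : ℝ)..1, G (x - y) * m y) + H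

/-- `(m, H)` is the unique smooth solution for the kernel `G`. -/
def IsUniqueSolution (α j : ℝ) (V G m : ℝ → ℝ) (H : ℝ) : Prop :=
  IsSolution α j V G m H ∧
    ∀ (m' : ℝ → ℝ) (H' : ℝ), IsSolution α j V G m' H' → m' = m ∧ H' = H

/-! Cesàro means are convolutions with the Fejér kernel, which is nonnegative and has mass one.
Convolution commutes with differentiation, so Fejér's theorem applied to `G`, `G'` and `G''` gives
convergence in C². Monotonicity of a kernel forces its cosine coefficients to be nonnegative, and
conversely a trigonometric sum with nonnegative cosine coefficients is monotone
(`IsMonotoneKernel.cosCoeff_nonneg`, `IsMonotoneKernel.cos_add_sin`), so the means inherit (a).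

For the system, put `u = H - V + G * m`; the equation says `m = (j² / (2u))^(1/α)`. Two estimates
carry everything.

A priori bound (`exists_one_lt_integral_congestionDensity`, `exists_lt_of_isSolution`): `V - G * m`
has second derivative bounded independently of the density `m`. If `min u` were small, `u` would lie
below a small constant plus a parabola, and since `α ≤ 2` the density would dominate a multiple of
`1 / (a + b y)`, whose integral diverges logarithmically as `a → 0`. Mass one therefore keeps `u`
above some `δ > 0` and `m` below a constant.

Stability (`exists_stability_const`): testing the difference of two equations with `m₁ - m₂`, the
monotone kernel has the good sign, the constants `H` drop out because the masses agree, and strict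
decrease of `s ↦ s^(-α)` on bounded intervals controls `m₁ - m₂`. Uniqueness is the case of equal
potentials.

Existence is by continuation in the coupling `t G`, from the explicit case `t = 0` to `t = 1`. Each
step is a Banach fixed point whose length does not depend on `t`, because both estimates are uniform
in `t`.

Finally, a solution for `Gₙ` solves the problem for `G` with potential `V - (Gₙ - G) * mₙ`, so
stability gives uniform convergence of `mₙ` and `Hₙ`; differentiating the formula for `m` upgrades
this to C². -/

/-! ### Convolution on the torus -/

/-- The convolution `∫_𝕋 G(x - y) f(y) dy`. -/
noncomputable def torusConv (G f : ℝ → ℝ) (x : ℝ) : ℝ :=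
  ∫ y in (0 : ℝ)..1, G (x - y) * f y

theorem exists_abs_le_of_periodic {f : ℝ → ℝ} (hf : Continuous f) (hp : Function.Periodic f 1) :
    ∃ C, 0 ≤ C ∧ ∀ x, |f x| ≤ C := by
  obtain ⟨C, hC⟩ := (hp.isBounded_of_continuous one_ne_zero hf).exists_norm_le
  exact ⟨C, (norm_nonneg _).trans (hC (f 0) ⟨0, rfl⟩), fun x => hC (f x) ⟨x, rfl⟩⟩

theorem periodic_deriv {f : ℝ → ℝ} (hp : Function.Periodic f 1) :
    Function.Periodic (deriv f) 1 := by
  intro x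
  have : (fun y => f (y + 1)) = f := funext hp
  rw [← deriv_comp_add_const, this]

theorem integral_comp_sub_of_periodic {f : ℝ → ℝ} (hp : Function.Periodic f 1) (x : ℝ) :
    ∫ y in (0 : ℝ)..1, f (x - y) = ∫ y in (0 : ℝ)..1, f y := by
  rw [intervalIntegral.integral_comp_sub_left]
  have := hp.intervalIntegral_add_eq (x - 1) 0
  simpa using this

theorem torusConv_periodic {G : ℝ → ℝ} (f : ℝ → ℝ) (hp : Function.Periodic G 1) :
    Function.Periodic (torusConv G f) 1 := by
  intro x
  simp only [torusConv]
  congr 1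
  ext y
  rw [show x + 1 - y = x - y + 1 by ring, hp]

theorem continuous_torusConv {G f : ℝ → ℝ} (hG : Continuous G) (hf : Continuous f) :
    Continuous (torusConv G f) := by
  unfold torusConv
  apply intervalIntegral.continuous_parametric_intervalIntegral_of_continuous'
  fun_prop

theorem hasDerivAt_torusConv {G f : ℝ → ℝ} (hG : Differentiable ℝ G)
    (hG' : Continuous (deriv G)) (hp : Function.Periodic G 1) (hf : Continuous f) (x : ℝ) :
    HasDerivAt (torusConv G f) (torusConv (deriv G) f x) x := by
  obtain ⟨C, -, hC⟩ := exists_abs_le_of_periodic hG' (periodic_deriv hp)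
  have hGc := hG.continuous
  refine (intervalIntegral.hasDerivAt_integral_of_dominated_loc_of_deriv_le
    (F := fun x y => G (x - y) * f y) (F' := fun x y => deriv G (x - y) * f y)
    (bound := fun y => C * |f y|) (s := Set.univ) univ_mem ?_ ?_ ?_ ?_ ?_ ?_).2
  · exact Eventually.of_forall fun x => (by fun_prop : Continuous _).aestronglyMeasurable
  · exact (by fun_prop : Continuous _).intervalIntegrable _ _
  · exact (by fun_prop : Continuous _).aestronglyMeasurable
  · refine Eventually.of_forall fun y _ x _ => ?_
    rw [Real.norm_eq_abs, abs_mul]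
    exact mul_le_mul_of_nonneg_right (hC _) (abs_nonneg _)
  · exact (by fun_prop : Continuous _).intervalIntegrable _ _
  · refine Eventually.of_forall fun y _ x _ => ?_
    have := ((hG (x - y)).hasDerivAt.comp_sub_const x y)
    exact this.mul_const _

theorem deriv_torusConv {G f : ℝ → ℝ} (hG : Differentiable ℝ G)
    (hG' : Continuous (deriv G)) (hp : Function.Periodic G 1) (hf : Continuous f) :
    deriv (torusConv G f) = torusConv (deriv G) f :=
  funext fun x => (hasDerivAt_torusConv hG hG' hp hf x).deriv

namespace IsC2Torus

variable {f g : ℝ → ℝ}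

theorem continuous (hf : IsC2Torus f) : Continuous f := hf.contDiff.continuous

theorem differentiable (hf : IsC2Torus f) : Differentiable ℝ f :=
  hf.contDiff.differentiable (by norm_num)

theorem contDiff_deriv (hf : IsC2Torus f) : ContDiff ℝ 1 (deriv f) := by
  have h := hf.contDiff
  rw [show (2 : WithTop ℕ∞) = 1 + 1 by norm_num, contDiff_succ_iff_deriv] at h
  exact h.2.2

theorem continuous_deriv (hf : IsC2Torus f) : Continuous (deriv f) :=
  hf.contDiff_deriv.continuous

theorem differentiable_deriv (hf : IsC2Torus f) : Differentiable ℝ (deriv f) :=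
  hf.contDiff_deriv.differentiable (by norm_num)

theorem continuous_deriv_deriv (hf : IsC2Torus f) : Continuous (deriv (deriv f)) :=
  (contDiff_one_iff_deriv.1 hf.contDiff_deriv).2

theorem mk_of_deriv (h1 : Differentiable ℝ f) (h2 : Differentiable ℝ (deriv f))
    (h3 : Continuous (deriv (deriv f))) (hp : Function.Periodic f 1) : IsC2Torus f := by
  refine ⟨?_, hp⟩
  rw [show (2 : WithTop ℕ∞) = 1 + 1 by norm_num, contDiff_succ_iff_deriv]
  exact ⟨h1, by simp, contDiff_one_iff_deriv.2 ⟨h2, h3⟩⟩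

theorem deriv_torusConv (hf : IsC2Torus f) (hg : Continuous g) :
    deriv (torusConv f g) = torusConv (deriv f) g :=
  _root_.deriv_torusConv hf.differentiable hf.continuous_deriv hf.periodic hg

theorem deriv_deriv_torusConv (hf : IsC2Torus f) (hg : Continuous g) :
    deriv (deriv (torusConv f g)) = torusConv (deriv (deriv f)) g := by
  rw [hf.deriv_torusConv hg]
  exact _root_.deriv_torusConv hf.differentiable_deriv hf.continuous_deriv_deriv
    (periodic_deriv hf.periodic) hg

theorem torusConv (hf : IsC2Torus f) (hg : Continuous g) : IsC2Torus (torusConv f g) := by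
  refine mk_of_deriv ?_ ?_ ?_ (torusConv_periodic _ hf.periodic)
  · exact fun x => (hasDerivAt_torusConv hf.differentiable hf.continuous_deriv hf.periodic hg
      x).differentiableAt
  · rw [hf.deriv_torusConv hg]
    exact fun x => (hasDerivAt_torusConv hf.differentiable_deriv hf.continuous_deriv_deriv
      (periodic_deriv hf.periodic) hg x).differentiableAt
  · rw [hf.deriv_deriv_torusConv hg]
    exact continuous_torusConv hf.continuous_deriv_deriv hg

theorem sub (hf : IsC2Torus f) (hg : IsC2Torus g) : IsC2Torus (fun x => f x - g x) :=
  ⟨hf.contDiff.sub hg.contDiff, hf.periodic.sub hg.periodic⟩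

theorem deriv_sub (hf : IsC2Torus f) (hg : IsC2Torus g) :
    deriv (fun x => f x - g x) = fun x => deriv f x - deriv g x :=
  funext fun x => _root_.deriv_fun_sub (hf.differentiable x) (hg.differentiable x)

theorem deriv_deriv_sub (hf : IsC2Torus f) (hg : IsC2Torus g) :
    deriv (deriv (fun x => f x - g x)) = fun x => deriv (deriv f) x - deriv (deriv g) x := by
  rw [hf.deriv_sub hg]
  exact funext fun x =>
    _root_.deriv_fun_sub (hf.differentiable_deriv x) (hg.differentiable_deriv x)

theorem const_mul (c : ℝ) (hf : IsC2Torus f) : IsC2Torus (fun x => c * f x) :=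
  ⟨contDiff_const.mul hf.contDiff, fun x => by simp only [hf.periodic x]⟩

theorem deriv_deriv_const_mul (c : ℝ) (f : ℝ → ℝ) :
    deriv (deriv (fun x => c * f x)) = fun x => c * deriv (deriv f) x := by
  have h (g : ℝ → ℝ) : deriv (fun x => c * g x) = fun x => c * deriv g x :=
    funext fun x => deriv_const_mul_field c
  rw [h, h]

theorem exists_abs_deriv_deriv_le (hf : IsC2Torus f) :
    ∃ K, 0 ≤ K ∧ ∀ x, |deriv (deriv f) x| ≤ K :=
  exists_abs_le_of_periodic hf.continuous_deriv_deriv (periodic_deriv (periodic_deriv hf.periodic))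

end IsC2Torus

theorem abs_torusConv_le {G f : ℝ → ℝ} {g : ℝ} (hG : Continuous G) (hf : Continuous f)
    (hg : ∀ x, |G x| ≤ g) (x : ℝ) :
    |torusConv G f x| ≤ g * ∫ y in (0 : ℝ)..1, |f y| := by
  unfold torusConv
  refine (intervalIntegral.abs_integral_le_integral_abs zero_le_one).trans ?_
  rw [← intervalIntegral.integral_const_mul]
  refine intervalIntegral.integral_mono_on zero_le_one
    ((by fun_prop : Continuous _).intervalIntegrable _ _)
    ((by fun_prop : Continuous _).intervalIntegrable _ _) fun y _ => ?_
  rw [abs_mul]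
  exact mul_le_mul_of_nonneg_right (hg _) (abs_nonneg _)

theorem abs_torusConv_le_of_density {G f : ℝ → ℝ} {g : ℝ} (hG : Continuous G)
    (hf : Continuous f) (hg : ∀ x, |G x| ≤ g) (hf0 : ∀ x, 0 ≤ f x)
    (hf1 : ∫ x in (0 : ℝ)..1, f x = 1) (x : ℝ) : |torusConv G f x| ≤ g := by
  have := abs_torusConv_le hG hf hg x
  simpa [abs_of_nonneg (hf0 _), hf1] using this

theorem torusConv_sub_left {G₁ G₂ f : ℝ → ℝ} (h1 : Continuous G₁) (h2 : Continuous G₂)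
    (hf : Continuous f) (x : ℝ) :
    torusConv (fun x => G₁ x - G₂ x) f x = torusConv G₁ f x - torusConv G₂ f x := by
  unfold torusConv
  rw [← intervalIntegral.integral_sub ((by fun_prop : Continuous _).intervalIntegrable _ _)
    ((by fun_prop : Continuous _).intervalIntegrable _ _)]
  simp only [sub_mul]

theorem torusConv_sub_right {G f₁ f₂ : ℝ → ℝ} (hG : Continuous G) (h1 : Continuous f₁)
    (h2 : Continuous f₂) (x : ℝ) :
    torusConv G (fun x => f₁ x - f₂ x) x = torusConv G f₁ x - torusConv G f₂ x := by
  unfold torusConv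
  rw [← intervalIntegral.integral_sub ((by fun_prop : Continuous _).intervalIntegrable _ _)
    ((by fun_prop : Continuous _).intervalIntegrable _ _)]
  simp only [mul_sub]

theorem torusConv_const_mul_left (c : ℝ) (G f : ℝ → ℝ) (x : ℝ) :
    torusConv (fun x => c * G x) f x = c * torusConv G f x := by
  unfold torusConv
  rw [← intervalIntegral.integral_const_mul]
  simp only [mul_assoc]

/-! ### The Fejér kernel -/

theorem integral_cos_two_pi_mul (k : ℕ) (hk : k ≠ 0) :
    ∫ x in (0 : ℝ)..1, Real.cos (2 * Real.pi * k * x) = 0 := by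
  have h : (2 * Real.pi * k : ℝ) ≠ 0 := by positivity
  rw [intervalIntegral.integral_comp_mul_left _ h, integral_cos]
  have : Real.sin (2 * Real.pi * k * 1) = 0 := by
    rw [show 2 * Real.pi * k * 1 = ((2 * k : ℕ) : ℝ) * Real.pi by push_cast; ring]
    exact Real.sin_nat_mul_pi _
  rw [this]
  simp

theorem integral_sin_two_pi_mul (k : ℕ) :
    ∫ x in (0 : ℝ)..1, Real.sin (2 * Real.pi * k * x) = 0 := by
  rcases eq_or_ne k 0 with rfl | hk
  · simp
  have h : (2 * Real.pi * k : ℝ) ≠ 0 := by positivity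
  rw [intervalIntegral.integral_comp_mul_left _ h, integral_sin]
  have : Real.cos (2 * Real.pi * k * 1) = 1 := by
    rw [show 2 * Real.pi * k * 1 = (k : ℝ) * (2 * Real.pi) by ring]
    exact Real.cos_nat_mul_two_pi _
  rw [this]
  simp

theorem periodic_cos_two_pi_mul (k : ℕ) :
    Function.Periodic (fun x : ℝ => Real.cos (2 * Real.pi * k * x)) 1 := by
  intro x
  dsimp only
  rw [show 2 * Real.pi * k * (x + 1) = 2 * Real.pi * k * x + k * (2 * Real.pi) by ring,
    Real.cos_add_nat_mul_two_pi]

theorem periodic_sin_two_pi_mul (k : ℕ) :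
    Function.Periodic (fun x : ℝ => Real.sin (2 * Real.pi * k * x)) 1 := by
  intro x
  dsimp only
  rw [show 2 * Real.pi * k * (x + 1) = 2 * Real.pi * k * x + k * (2 * Real.pi) by ring,
    Real.sin_add_nat_mul_two_pi]

/-- The Dirichlet kernel `1 + 2 ∑_{i=1}^k cos(2πiz)`. -/
noncomputable def dirichletKernel (k : ℕ) (z : ℝ) : ℝ :=
  1 + ∑ i ∈ Finset.Icc 1 k, 2 * Real.cos (2 * Real.pi * i * z)

/-- The Fejér kernel, the Cesàro mean of the Dirichlet kernels. -/
noncomputable def fejerKernel (n : ℕ) (z : ℝ) : ℝ :=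
  (∑ k ∈ Finset.range (n + 1), dirichletKernel k z) / ((n : ℝ) + 1)

theorem continuous_dirichletKernel (k : ℕ) : Continuous (dirichletKernel k) := by
  unfold dirichletKernel
  fun_prop

theorem continuous_fejerKernel (n : ℕ) : Continuous (fejerKernel n) := by
  unfold fejerKernel
  have := continuous_dirichletKernel
  fun_prop

theorem dirichletKernel_succ (k : ℕ) (z : ℝ) :
    dirichletKernel (k + 1) z = dirichletKernel k z
      + 2 * Real.cos (2 * Real.pi * (k + 1) * z) := by
  simp [dirichletKernel, Finset.sum_Icc_succ_top, add_assoc]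

/-- Multiplying by `1 - cos` instead of dividing by a sine keeps the identity valid at integers, and
the right side telescopes when summed over `k`. -/
theorem dirichletKernel_mul_one_sub_cos (k : ℕ) (z : ℝ) :
    dirichletKernel k z * (1 - Real.cos (2 * Real.pi * z)) =
      Real.cos (2 * Real.pi * k * z) - Real.cos (2 * Real.pi * (k + 1) * z) := by
  induction k with
  | zero => simp [dirichletKernel]
  | succ k ih =>
    rw [dirichletKernel_succ, add_mul, ih]
    push_cast
    have h1 : Real.cos (2 * Real.pi * (k + 1 + 1) * z) =
        Real.cos (2 * Real.pi * (k + 1) * z + 2 * Real.pi * z) := by congr 1; ring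
    have h2 : Real.cos (2 * Real.pi * k * z) =
        Real.cos (2 * Real.pi * (k + 1) * z - 2 * Real.pi * z) := by congr 1; ring
    rw [h1, h2, Real.cos_add, Real.cos_sub]
    ring

/-- This one identity yields both facts needed about the kernel: its sign, and its concentration at
the integers at rate `2 / (n + 1)`. -/
theorem fejerKernel_mul_one_sub_cos (n : ℕ) (z : ℝ) :
    fejerKernel n z * (1 - Real.cos (2 * Real.pi * z)) =
      (1 - Real.cos (2 * Real.pi * (n + 1) * z)) / (n + 1) := by
  rw [fejerKernel, div_mul_eq_mul_div, Finset.sum_mul]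
  congr 1
  simp only [dirichletKernel_mul_one_sub_cos]
  have := Finset.sum_range_sub' (fun k : ℕ => Real.cos (2 * Real.pi * k * z)) (n + 1)
  push_cast at this
  simpa using this

theorem fejerKernel_nonneg (n : ℕ) (z : ℝ) : 0 ≤ fejerKernel n z := by
  rcases (Real.cos_le_one (2 * Real.pi * z)).lt_or_eq with h | h
  · have h1 := fejerKernel_mul_one_sub_cos n z
    have h2 : 0 ≤ (1 - Real.cos (2 * Real.pi * (n + 1) * z)) / ((n : ℝ) + 1) :=
      div_nonneg (by linarith [Real.cos_le_one (2 * Real.pi * (n + 1) * z)]) (by positivity)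
    rw [← h1] at h2
    exact nonneg_of_mul_nonneg_left h2 (by linarith)
  -- At integers the identity reads `0 = 0`, but there every cosine in the kernel equals one.
  · obtain ⟨m, hm⟩ := (Real.cos_eq_one_iff _).1 h
    have h1 (i : ℕ) : Real.cos (2 * Real.pi * i * z) = 1 := by
      refine (Real.cos_eq_one_iff _).2 ⟨i * m, ?_⟩
      push_cast
      linear_combination (i : ℝ) * hm
    simp only [fejerKernel, dirichletKernel, h1]
    positivity

theorem integral_dirichletKernel (k : ℕ) : ∫ z in (0 : ℝ)..1, dirichletKernel k z = 1 := by
  unfold dirichletKernel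
  rw [intervalIntegral.integral_add (by simp)
    ((by fun_prop : Continuous _).intervalIntegrable _ _),
    intervalIntegral.integral_finsetSum
      fun i _ => (by fun_prop : Continuous _).intervalIntegrable _ _]
  rw [Finset.sum_eq_zero]
  · simp
  · intro i hi
    rw [intervalIntegral.integral_const_mul, integral_cos_two_pi_mul i, mul_zero]
    have := (Finset.mem_Icc.1 hi).1
    omega

theorem integral_fejerKernel (n : ℕ) : ∫ z in (0 : ℝ)..1, fejerKernel n z = 1 := by
  unfold fejerKernel
  rw [intervalIntegral.integral_div, intervalIntegral.integral_finsetSum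
      fun i _ => (continuous_dirichletKernel i).intervalIntegrable _ _]
  simp only [integral_dirichletKernel]
  have : (n : ℝ) + 1 ≠ 0 := by positivity
  simp [this]

theorem exists_abs_sub_lt_of_periodic {g : ℝ → ℝ} (hg : Continuous g)
    (hp : Function.Periodic g 1) {ε : ℝ} (hε : 0 < ε) :
    ∃ δ, 0 < δ ∧ ∀ x w, |w| < δ → |g (x - w) - g x| < ε := by
  -- After reduction to the fractional part, both `x` and `x - w` with `|w| < 1` lie in `[-1, 2]`.
  have huc := (isCompact_Icc (a := (-1 : ℝ)) (b := 2)).uniformContinuousOn_of_continuous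
    hg.continuousOn
  obtain ⟨δ, hδ, h⟩ := Metric.uniformContinuousOn_iff.1 huc ε hε
  refine ⟨min δ 1, by positivity, fun x w hw => ?_⟩
  obtain ⟨hw1, hw2⟩ := lt_min_iff.1 hw
  have h1 : g x = g (Int.fract x) := by
    have := hp.sub_int_mul_eq (x := x) ⌊x⌋
    rwa [mul_one, Int.self_sub_floor, eq_comm] at this
  have h2 : g (x - w) = g (Int.fract x - w) := by
    rw [← Int.self_sub_floor, show x - ⌊x⌋ - w = x - w - ⌊x⌋ by ring]
    simpa using (hp.sub_int_mul_eq (x := x - w) ⌊x⌋).symm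
  obtain ⟨hw3, hw4⟩ := abs_lt.1 hw2
  have h3 := Int.fract_nonneg x
  have h4 := Int.fract_lt_one x
  rw [h1, h2, ← Real.dist_eq]
  exact h _ ⟨by linarith, by linarith⟩ _ ⟨by linarith, by linarith⟩
    (by simpa [Real.dist_eq] using hw1)

/-- The near/far split of Fejér's argument is absorbed into one pointwise bound, whose weight `1 -
cos` is exactly what the Fejér kernel can be integrated against. The constant compares the trivial
bound `2B` with `1 - cos(2πw) ≥ 8w² ≥ 8δ²` for `δ ≤ |w| ≤ 1/2`. -/
theorem exists_abs_sub_le_add_one_sub_cos {g : ℝ → ℝ} (hg : Continuous g)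
    (hp : Function.Periodic g 1) {ε : ℝ} (hε : 0 < ε) :
    ∃ C, 0 ≤ C ∧ ∀ x z, |g (x - z) - g x| ≤ ε + C * (1 - Real.cos (2 * Real.pi * z)) := by
  obtain ⟨B, hB0, hB⟩ := exists_abs_le_of_periodic hg hp
  obtain ⟨δ, hδ, h⟩ := exists_abs_sub_lt_of_periodic hg hp hε
  refine ⟨2 * B / (8 * δ ^ 2), by positivity, fun x z => ?_⟩
  have hr : |z - round z| ≤ 1 / 2 := abs_sub_round z
  have hg' : g (x - z) = g (x - (z - round z)) := by
    have := (hp.int_mul (round z)) (x - z)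
    rw [← this]
    congr 1
    ring
  have hc' : Real.cos (2 * Real.pi * z) = Real.cos (2 * Real.pi * (z - round z)) := by
    rw [show 2 * Real.pi * (z - round z) = 2 * Real.pi * z - (round z : ℤ) * (2 * Real.pi) by ring,
      Real.cos_sub_int_mul_two_pi]
  rw [hg', hc']
  generalize z - round z = w at hr
  have hcos : 8 * w ^ 2 ≤ 1 - Real.cos (2 * Real.pi * w) := by
    have h1 : |2 * Real.pi * w| ≤ Real.pi := by
      rw [abs_mul, abs_of_pos Real.two_pi_pos]
      nlinarith [Real.pi_pos]
    have h2 := Real.cos_le_one_sub_mul_cos_sq h1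
    have h3 : 2 / Real.pi ^ 2 * (2 * Real.pi * w) ^ 2 = 8 * w ^ 2 := by
      field_simp
      ring
    linarith
  rcases lt_or_ge |w| δ with hw | hw
  · have h1 := h x w hw
    have h2 : 0 ≤ 2 * B / (8 * δ ^ 2) * (1 - Real.cos (2 * Real.pi * w)) :=
      mul_nonneg (by positivity) (by linarith [Real.cos_le_one (2 * Real.pi * w)])
    linarith
  · have h1 : |g (x - w) - g x| ≤ 2 * B := by
      linarith [abs_sub (g (x - w)) (g x), hB (x - w), hB x]
    have h2 : δ ^ 2 ≤ w ^ 2 := by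
      rw [← sq_abs w]
      gcongr
    have h3 : 2 * B = 2 * B / (8 * δ ^ 2) * (8 * δ ^ 2) := by field_simp
    have h4 : 2 * B / (8 * δ ^ 2) * (8 * δ ^ 2) ≤
        2 * B / (8 * δ ^ 2) * (1 - Real.cos (2 * Real.pi * w)) := by
      gcongr
      linarith
    linarith

/-- **Fejér's theorem**: the Fejér means of a continuous function converge uniformly. -/
theorem tendstoUniformly_torusConv_fejerKernel {g : ℝ → ℝ} (hg : Continuous g)
    (hp : Function.Periodic g 1) :
    TendstoUniformly (fun n => torusConv g (fejerKernel n)) g atTop := by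
  rw [Metric.tendstoUniformly_iff]
  intro ε hε
  obtain ⟨C, hC0, hC⟩ := exists_abs_sub_le_add_one_sub_cos hg hp (half_pos hε)
  have hlim : Tendsto (fun n : ℕ => C * 2 / ((n : ℝ) + 1)) atTop (𝓝 0) := by
    have := (tendsto_one_div_add_atTop_nhds_zero_nat (𝕜 := ℝ)).const_mul (C * 2)
    simpa [div_eq_mul_inv] using this
  filter_upwards [hlim.eventually (gt_mem_nhds (half_pos hε))] with n hn x
  have hF := continuous_fejerKernel n
  have h1 : torusConv g (fejerKernel n) x - g x =
      ∫ z in (0 : ℝ)..1, (g (x - z) - g x) * fejerKernel n z := by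
    simp only [sub_mul]
    rw [intervalIntegral.integral_sub ((by fun_prop : Continuous _).intervalIntegrable _ _)
      ((by fun_prop : Continuous _).intervalIntegrable _ _), intervalIntegral.integral_const_mul,
      integral_fejerKernel, mul_one]
    rfl
  rw [dist_comm, Real.dist_eq, h1]
  calc _ ≤ ∫ z in (0 : ℝ)..1, |(g (x - z) - g x) * fejerKernel n z| :=
        intervalIntegral.abs_integral_le_integral_abs zero_le_one
    _ ≤ ∫ z in (0 : ℝ)..1, (ε / 2 * fejerKernel n z + C * 2 / ((n : ℝ) + 1)) := by
        refine intervalIntegral.integral_mono_on zero_le_one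
          ((by fun_prop : Continuous _).intervalIntegrable _ _)
          ((by fun_prop : Continuous _).intervalIntegrable _ _) fun z _ => ?_
        have h0 := fejerKernel_nonneg n z
        have h2 := fejerKernel_mul_one_sub_cos n z
        have h3 : fejerKernel n z * (1 - Real.cos (2 * Real.pi * z)) ≤ 2 / (n + 1) := by
          rw [h2]
          gcongr
          linarith [Real.neg_one_le_cos (2 * Real.pi * (n + 1) * z)]
        rw [abs_mul, abs_of_nonneg h0]
        calc _ ≤ (ε / 2 + C * (1 - Real.cos (2 * Real.pi * z))) * fejerKernel n z := by
              gcongr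
              exact hC x z
          _ = ε / 2 * fejerKernel n z
              + C * (fejerKernel n z * (1 - Real.cos (2 * Real.pi * z))) := by ring
          _ ≤ ε / 2 * fejerKernel n z + C * (2 / (n + 1)) := by gcongr
          _ = _ := by ring
    _ = ε / 2 + C * 2 / ((n : ℝ) + 1) := by
        rw [intervalIntegral.integral_add ((by fun_prop : Continuous _).intervalIntegrable _ _)
          ((by fun_prop : Continuous _).intervalIntegrable _ _),
          intervalIntegral.integral_const_mul, integral_fejerKernel]
        simp
    _ < ε := by linarith

/-! ### Cesàro means of Fourier series -/

theorem fourier_term_eq {f : ℝ → ℝ} (hf : Continuous f) (hp : Function.Periodic f 1)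
    {k : ℕ} (hk : k ≠ 0) (x : ℝ) :
    cosCoeff f k * Real.cos (2 * Real.pi * k * x) + sinCoeff f k * Real.sin (2 * Real.pi * k * x) =
      torusConv f (fun z => 2 * Real.cos (2 * Real.pi * k * z)) x := by
  have h := integral_comp_sub_of_periodic
    (f := fun z => f (x - z) * (2 * Real.cos (2 * Real.pi * k * z))) (fun z => by
      simp only [periodic_cos_two_pi_mul k z]
      rw [← hp (x - (z + 1))]
      congr 2
      ring) x
  rw [torusConv, ← h, cosCoeff, sinCoeff, if_neg hk]
  rw [mul_comm, mul_comm _ (Real.sin _), ← intervalIntegral.integral_const_mul,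
    ← intervalIntegral.integral_const_mul, ← intervalIntegral.integral_const_mul,
    ← intervalIntegral.integral_const_mul,
    ← intervalIntegral.integral_add ((by fun_prop : Continuous _).intervalIntegrable _ _)
      ((by fun_prop : Continuous _).intervalIntegrable _ _)]
  congr 1
  ext y
  rw [sub_sub_cancel, mul_sub, Real.cos_sub]
  ring

theorem trigSum_fourier_eq {f : ℝ → ℝ} (hf : Continuous f) (hp : Function.Periodic f 1)
    (k : ℕ) : trigSum k (cosCoeff f) (sinCoeff f) = torusConv f (dirichletKernel k) := by
  ext x
  have h0 : cosCoeff f 0 = ∫ y in (0 : ℝ)..1, f (x - y) := by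
    rw [integral_comp_sub_of_periodic hp]
    simp [cosCoeff]
  rw [trigSum, Finset.sum_congr rfl fun i hi =>
    fourier_term_eq hf hp (Nat.one_le_iff_ne_zero.1 (Finset.mem_Icc.1 hi).1) x, h0]
  unfold torusConv dirichletKernel
  rw [← intervalIntegral.integral_finsetSum
    fun i _ => (by fun_prop : Continuous _).intervalIntegrable _ _,
    ← intervalIntegral.integral_add ((by fun_prop : Continuous _).intervalIntegrable _ _)
      ((by fun_prop : Continuous _).intervalIntegrable _ _)]
  simp only [mul_add, Finset.mul_sum, mul_one]

theorem cesaroMean_eq_torusConv {f : ℝ → ℝ} (hf : Continuous f) (hp : Function.Periodic f 1)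
    (n : ℕ) : cesaroMean f n = torusConv f (fejerKernel n) := by
  ext x
  unfold cesaroMean
  have h (k : ℕ) := congrFun (trigSum_fourier_eq hf hp k) x
  simp only [h, torusConv, fejerKernel]
  have := continuous_dirichletKernel
  rw [← intervalIntegral.integral_finsetSum
    fun i _ => (by fun_prop : Continuous _).intervalIntegrable _ _,
    ← intervalIntegral.integral_div]
  simp only [← Finset.mul_sum, mul_div_assoc]

/-- Frequency `k` occurs in the partial sums of index `k, …, n`, hence `n + 1 - k` times. -/
theorem sum_trigSum (p q : ℕ → ℝ) (n : ℕ) (x : ℝ) :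
    ∑ k ∈ Finset.range (n + 1), trigSum k p q x =
      trigSum n (fun k => ((n : ℝ) + 1 - k) * p k) (fun k => ((n : ℝ) + 1 - k) * q k) x := by
  induction n with
  | zero => simp [trigSum]
  | succ n ih =>
    rw [Finset.sum_range_succ, ih]
    simp only [trigSum, Finset.sum_Icc_succ_top (Nat.le_add_left 1 n)]
    push_cast
    have : ∑ k ∈ Finset.Icc 1 n, (((n : ℝ) + 1 + 1 - k) * p k * Real.cos (2 * Real.pi * k * x)
        + ((n : ℝ) + 1 + 1 - k) * q k * Real.sin (2 * Real.pi * k * x)) =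
        ∑ k ∈ Finset.Icc 1 n, (((n : ℝ) + 1 - k) * p k * Real.cos (2 * Real.pi * k * x)
        + ((n : ℝ) + 1 - k) * q k * Real.sin (2 * Real.pi * k * x)) +
        ∑ k ∈ Finset.Icc 1 n, (p k * Real.cos (2 * Real.pi * k * x)
        + q k * Real.sin (2 * Real.pi * k * x)) := by
      rw [← Finset.sum_add_distrib]
      exact Finset.sum_congr rfl fun k _ => by ring
    rw [this]
    ring

theorem isTrigPolynomial_cesaroMean (f : ℝ → ℝ) (n : ℕ) : IsTrigPolynomial (cesaroMean f n) := by
  refine ⟨n, fun k => ((n : ℝ) + 1 - k) * cosCoeff f k / (n + 1),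
    fun k => ((n : ℝ) + 1 - k) * sinCoeff f k / (n + 1), ?_⟩
  ext x
  rw [cesaroMean, sum_trigSum, trigSum, trigSum, add_div, Finset.sum_div]
  congr 1
  exact Finset.sum_congr rfl fun k _ => by ring

theorem continuous_trigSum (n : ℕ) (p q : ℕ → ℝ) : Continuous (trigSum n p q) := by
  unfold trigSum
  fun_prop

theorem integral_trigSum (n : ℕ) (p q : ℕ → ℝ) : ∫ x in (0 : ℝ)..1, trigSum n p q x = p 0 := by
  unfold trigSum
  rw [intervalIntegral.integral_add (by simp)
    ((by fun_prop : Continuous _).intervalIntegrable _ _),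
    intervalIntegral.integral_finsetSum
      fun i _ => (by fun_prop : Continuous _).intervalIntegrable _ _]
  rw [Finset.sum_eq_zero]
  · simp
  · intro i hi
    rw [intervalIntegral.integral_add ((by fun_prop : Continuous _).intervalIntegrable _ _)
      ((by fun_prop : Continuous _).intervalIntegrable _ _),
      intervalIntegral.integral_const_mul, intervalIntegral.integral_const_mul,
      integral_cos_two_pi_mul i, integral_sin_two_pi_mul i]
    · simp
    · exact Nat.one_le_iff_ne_zero.1 (Finset.mem_Icc.1 hi).1

theorem hasPositiveWeight_cesaroMean {f : ℝ → ℝ} (hf : HasPositiveWeight f) (n : ℕ) :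
    HasPositiveWeight (cesaroMean f n) := by
  have h : ∫ x in (0 : ℝ)..1, cesaroMean f n x = ∫ x in (0 : ℝ)..1, f x := by
    unfold cesaroMean
    rw [intervalIntegral.integral_div, intervalIntegral.integral_finsetSum
      fun i _ => (continuous_trigSum i _ _).intervalIntegrable _ _]
    simp only [integral_trigSum]
    have : (n : ℝ) + 1 ≠ 0 := by positivity
    simp [cosCoeff, this]
  rw [HasPositiveWeight, h]
  exact hf

/-! ### Monotone kernels -/

theorem isMonotoneKernel_iff {G : ℝ → ℝ} :
    IsMonotoneKernel G ↔ ∀ f : ℝ → ℝ, Continuous f → Function.Periodic f 1 →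
      0 ≤ ∫ x in (0 : ℝ)..1, torusConv G f x * f x := by
  have h (f : ℝ → ℝ) : (∫ x in (0 : ℝ)..1, ∫ y in (0 : ℝ)..1, G (x - y) * f x * f y) =
      ∫ x in (0 : ℝ)..1, torusConv G f x * f x := by
    congr 1
    ext x
    rw [torusConv, ← intervalIntegral.integral_mul_const]
    congr 1
    ext y
    ring
  simp only [IsMonotoneKernel, h]

namespace IsMonotoneKernel

theorem add {G₁ G₂ : ℝ → ℝ} (c1 : Continuous G₁) (c2 : Continuous G₂)
    (h1 : IsMonotoneKernel G₁) (h2 : IsMonotoneKernel G₂) :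
    IsMonotoneKernel (fun x => G₁ x + G₂ x) := by
  rw [isMonotoneKernel_iff] at *
  intro f hf hp
  have hsum (x : ℝ) : torusConv (fun x => G₁ x + G₂ x) f x * f x =
      torusConv G₁ f x * f x + torusConv G₂ f x * f x := by
    rw [← add_mul]
    unfold torusConv
    rw [← intervalIntegral.integral_add ((by fun_prop : Continuous _).intervalIntegrable _ _)
      ((by fun_prop : Continuous _).intervalIntegrable _ _)]
    simp only [add_mul]
  have := continuous_torusConv c1 hf
  have := continuous_torusConv c2 hf
  simp only [hsum]
  rw [intervalIntegral.integral_add ((by fun_prop : Continuous _).intervalIntegrable _ _)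
      ((by fun_prop : Continuous _).intervalIntegrable _ _)]
  exact add_nonneg (h1 f hf hp) (h2 f hf hp)

theorem const_mul {G : ℝ → ℝ} {c : ℝ} (hc : 0 ≤ c) (h : IsMonotoneKernel G) :
    IsMonotoneKernel (fun x => c * G x) := by
  rw [isMonotoneKernel_iff] at *
  intro f hf hp
  simp only [torusConv_const_mul_left, mul_assoc, intervalIntegral.integral_const_mul]
  exact mul_nonneg hc (h f hf hp)

theorem sum {ι : Type*} (s : Finset ι) {G : ι → ℝ → ℝ} (hc : ∀ i ∈ s, Continuous (G i))
    (h : ∀ i ∈ s, IsMonotoneKernel (G i)) : IsMonotoneKernel (fun x => ∑ i ∈ s, G i x) := by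
  classical
  induction s using Finset.induction_on with
  | empty => intro f _ _; simp
  | insert a s ha ih =>
    simp only [Finset.sum_insert ha]
    refine add (hc a (by simp)) (continuous_finsetSum _ fun i hi => hc i (by simp [hi]))
      (h a (by simp)) (ih (fun i hi => hc i (by simp [hi])) fun i hi => h i (by simp [hi]))

theorem const {c : ℝ} (hc : 0 ≤ c) : IsMonotoneKernel fun _ => c := by
  rw [isMonotoneKernel_iff]
  intro f _ _
  simp only [torusConv, intervalIntegral.integral_const_mul]
  rw [mul_assoc]
  exact mul_nonneg hc (mul_self_nonneg _)

/-- With `a`, `b` the cosine and sine moments of `f`, the quadratic form equals `p (a² + b²)`; the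
sine part is antisymmetric in `x`, `y` and cancels. -/
theorem cos_add_sin {p : ℝ} (hp : 0 ≤ p) (q : ℝ) (k : ℕ) :
    IsMonotoneKernel fun x =>
      p * Real.cos (2 * Real.pi * k * x) + q * Real.sin (2 * Real.pi * k * x) := by
  rw [isMonotoneKernel_iff]
  intro f hf _
  set a := ∫ y in (0 : ℝ)..1, Real.cos (2 * Real.pi * k * y) * f y with ha
  set b := ∫ y in (0 : ℝ)..1, Real.sin (2 * Real.pi * k * y) * f y with hb
  have h1 (x : ℝ) : torusConv (fun x =>
      p * Real.cos (2 * Real.pi * k * x) + q * Real.sin (2 * Real.pi * k * x)) f x * f x =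
      (p * a - q * b) * (Real.cos (2 * Real.pi * k * x) * f x)
      + (p * b + q * a) * (Real.sin (2 * Real.pi * k * x) * f x) := by
    have : torusConv (fun x =>
        p * Real.cos (2 * Real.pi * k * x) + q * Real.sin (2 * Real.pi * k * x)) f x =
        (p * Real.cos (2 * Real.pi * k * x) + q * Real.sin (2 * Real.pi * k * x)) * a
        + (p * Real.sin (2 * Real.pi * k * x) - q * Real.cos (2 * Real.pi * k * x)) * b := by
      rw [ha, hb, ← intervalIntegral.integral_const_mul, ← intervalIntegral.integral_const_mul,
        ← intervalIntegral.integral_add ((by fun_prop : Continuous _).intervalIntegrable _ _)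
          ((by fun_prop : Continuous _).intervalIntegrable _ _)]
      unfold torusConv
      congr 1
      ext y
      simp only [mul_sub, Real.cos_sub, Real.sin_sub]
      ring
    rw [this]
    ring
  simp only [h1]
  rw [intervalIntegral.integral_add ((by fun_prop : Continuous _).intervalIntegrable _ _)
    ((by fun_prop : Continuous _).intervalIntegrable _ _), intervalIntegral.integral_const_mul,
    intervalIntegral.integral_const_mul, ← ha, ← hb]
  nlinarith [mul_nonneg hp (sq_nonneg a), mul_nonneg hp (sq_nonneg b)]

/-- Test with `cos(2πkx)` and with `sin(2πkx)` and add: by the addition formula the integrand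
becomes `G(x - y) cos(2πk(x - y))`, whose double integral is the coefficient up to a positive
factor. -/
theorem cosCoeff_nonneg {G : ℝ → ℝ} (hc : Continuous G) (hp : Function.Periodic G 1)
    (h : IsMonotoneKernel G) (k : ℕ) : 0 ≤ cosCoeff G k := by
  rw [isMonotoneKernel_iff] at h
  have hC := periodic_cos_two_pi_mul k
  have hS := periodic_sin_two_pi_mul k
  have h1 := h _ (by fun_prop) hC
  have h2 := h _ (by fun_prop) hS
  have c1 := continuous_torusConv (f := fun x => Real.cos (2 * Real.pi * k * x)) hc (by fun_prop)
  have c2 := continuous_torusConv (f := fun x => Real.sin (2 * Real.pi * k * x)) hc (by fun_prop)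
  have h3 : 0 ≤ ∫ x in (0 : ℝ)..1, G x * Real.cos (2 * Real.pi * k * x) := by
    have h4 := add_nonneg h1 h2
    rw [← intervalIntegral.integral_add ((by fun_prop : Continuous _).intervalIntegrable _ _)
      ((by fun_prop : Continuous _).intervalIntegrable _ _)] at h4
    have h5 (x : ℝ) : torusConv G (fun x => Real.cos (2 * Real.pi * k * x)) x
          * Real.cos (2 * Real.pi * k * x)
        + torusConv G (fun x => Real.sin (2 * Real.pi * k * x)) x
          * Real.sin (2 * Real.pi * k * x) =
        ∫ x in (0 : ℝ)..1, G x * Real.cos (2 * Real.pi * k * x) := by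
      have h6 := integral_comp_sub_of_periodic (hp.mul hC) x
      simp only [Pi.mul_apply] at h6
      rw [← h6, torusConv, torusConv,
        ← intervalIntegral.integral_mul_const, ← intervalIntegral.integral_mul_const,
        ← intervalIntegral.integral_add ((by fun_prop : Continuous _).intervalIntegrable _ _)
          ((by fun_prop : Continuous _).intervalIntegrable _ _)]
      congr 1
      ext y
      simp only [mul_sub, Real.cos_sub]
      ring
    simpa only [h5, intervalIntegral.integral_const, sub_zero, one_smul] using h4
  rw [cosCoeff]
  split_ifs with hk
  · simpa [hk] using h3
  · positivity

theorem cesaroMean {G : ℝ → ℝ} (hc : Continuous G) (hp : Function.Periodic G 1)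
    (h : IsMonotoneKernel G) (n : ℕ) : IsMonotoneKernel (cesaroMean G n) := by
  -- Each partial sum is already monotone; the averaging serves only the convergence.
  have hk (k : ℕ) : IsMonotoneKernel (trigSum k (cosCoeff G) (sinCoeff G)) := by
    unfold trigSum
    exact add (by fun_prop) (by fun_prop) (const (h.cosCoeff_nonneg hc hp 0))
      (sum _ (fun i _ => by fun_prop) fun i _ => cos_add_sin (h.cosCoeff_nonneg hc hp i) _ _)
  have := (sum (Finset.range (n + 1)) (fun k _ => continuous_trigSum k _ _)
    fun k _ => hk k).const_mul (c := ((n : ℝ) + 1)⁻¹) (by positivity)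
  convert this using 2 with x
  rw [_root_.cesaroMean, div_eq_inv_mul]

end IsMonotoneKernel

/-! ### The density as a function of the potential -/

/-- The solution `m > 0` of `j² / (2 m^α) = u`. -/
noncomputable def congestionDensity (α j u : ℝ) : ℝ := (j ^ 2 / (2 * u)) ^ (1 / α)

section Density

variable {α j : ℝ}

theorem congestionDensity_pos (hj : j ≠ 0) {u : ℝ} (hu : 0 < u) :
    0 < congestionDensity α j u :=
  Real.rpow_pos_of_pos (by positivity) _

theorem eq_congestionDensity_iff (hα : 0 < α) (hj : j ≠ 0) {u m : ℝ} (hm : 0 < m) (hu : 0 < u) :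
    m = congestionDensity α j u ↔ j ^ 2 / (2 * m ^ α) = u := by
  have hmα : 0 < m ^ α := Real.rpow_pos_of_pos hm _
  have hj2 : 0 < j ^ 2 := by positivity
  rw [congestionDensity, one_div, ← Real.rpow_left_inj hm.le (by positivity) hα.ne',
    Real.rpow_inv_rpow (by positivity) hα.ne', eq_div_iff (by positivity),
    div_eq_iff (by positivity)]
  constructor <;> intro h <;> linarith

theorem congestionDensity_anti (hα : 0 < α) {u v : ℝ} (hu : 0 < u) (huv : u ≤ v) :
    congestionDensity α j v ≤ congestionDensity α j u := by
  have hv : 0 < v := hu.trans_le huv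
  unfold congestionDensity
  gcongr

theorem continuousOn_congestionDensity (hα : 0 < α) :
    ContinuousOn (congestionDensity α j) (Set.Ioi 0) := by
  intro u hu
  have hu : u ≠ 0 := (Set.mem_Ioi.1 hu).ne'
  refine ContinuousAt.continuousWithinAt (ContinuousAt.rpow_const ?_ (Or.inr (by positivity)))
  exact continuousAt_const.div (by fun_prop) (by simpa using hu)

theorem contDiff_congestionDensity_comp (hj : j ≠ 0) {u : ℝ → ℝ}
    (hu : ContDiff ℝ 2 u) (hpos : ∀ x, 0 < u x) :
    ContDiff ℝ 2 fun x => congestionDensity α j (u x) := by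
  refine ContDiff.rpow_const_of_ne (contDiff_const.div (contDiff_const.mul hu) ?_) ?_
  · intro x
    have := hpos x
    positivity
  · intro x
    have := hpos x
    positivity

/-- Here `α ≤ 2` enters: since `S / s ≥ 1` and `1/α ≥ 1/2`, the density is at least as singular as
`s^(-1/2)`, the borderline power that is not integrable across a quadratic zero of `s`. -/
theorem exists_div_sqrt_le_congestionDensity (hα : 0 < α) (hα2 : α ≤ 2) (hj : j ≠ 0) {S : ℝ}
    (hS : 0 < S) :
    ∃ c, 0 < c ∧ ∀ s, 0 < s → s ≤ S → c / √s ≤ congestionDensity α j s := by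
  refine ⟨(j ^ 2 / (2 * S)) ^ (1 / α) * √S, by positivity, fun s hs hsS => ?_⟩
  have h1 : congestionDensity α j s = (j ^ 2 / (2 * S)) ^ (1 / α) * (S / s) ^ (1 / α) := by
    rw [congestionDensity, ← Real.mul_rpow (by positivity) (by positivity)]
    congr 1
    field_simp
  have h2 : (S / s) ^ (1 / 2 : ℝ) ≤ (S / s) ^ (1 / α) :=
    Real.rpow_le_rpow_of_exponent_le ((one_le_div hs).2 hsS)
      (one_div_le_one_div_of_le hα hα2)
  rw [← Real.sqrt_eq_rpow, Real.sqrt_div hS.le] at h2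
  rw [h1, mul_div_assoc]
  gcongr

end Density

/-! ### Blow-up of the mass, and the problem without coupling. -/

theorem exists_forall_le_of_periodic {f : ℝ → ℝ} (hf : Continuous f)
    (hp : Function.Periodic f 1) : ∃ x₀, ∀ x, f x ≤ f x₀ := by
  obtain ⟨x₀, -, h⟩ := (isCompact_Icc (a := (0 : ℝ)) (b := 1)).exists_isMaxOn
    ⟨0, by simp⟩ hf.continuousOn
  refine ⟨x₀, fun x => ?_⟩
  obtain ⟨y, hy, hxy⟩ := hp.exists_mem_Ico₀ one_pos x
  rw [hxy]
  exact h ⟨hy.1, hy.2.le⟩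

/-- The mean value inequality is applied twice, first to `W'`, which vanishes at the maximum, then
to `W`. This loses the factor `1/2` of Taylor's formula, which is harmless. -/
theorem IsC2Torus.sub_le_mul_sq_of_max {W : ℝ → ℝ} (hW : IsC2Torus W) {K x₀ : ℝ} (hK0 : 0 ≤ K)
    (hK : ∀ x, |deriv (deriv W) x| ≤ K) (hmax : ∀ x, W x ≤ W x₀) (y : ℝ) :
    W x₀ - W (x₀ + y) ≤ K * y ^ 2 := by
  have hd0 : deriv W x₀ = 0 := IsLocalMax.deriv_eq_zero (Eventually.of_forall hmax)
  have h1 (x : ℝ) : |deriv W x| ≤ K * |x - x₀| := by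
    have := convex_univ.norm_image_sub_le_of_norm_deriv_le (f := deriv W) (C := K)
      (fun x _ => hW.differentiable_deriv x) (fun x _ => hK x) (Set.mem_univ x₀) (Set.mem_univ x)
    simpa [hd0] using this
  have h2 := (convex_closedBall x₀ |y|).norm_image_sub_le_of_norm_deriv_le (f := W)
    (C := K * |y|) (x := x₀) (y := x₀ + y) (fun x _ => hW.differentiable x)
    (fun x hx => (h1 x).trans (by
      rw [Metric.mem_closedBall, Real.dist_eq] at hx
      gcongr)) (by simp) (by simp)
  rw [Real.norm_eq_abs, Real.norm_eq_abs, add_sub_cancel_left, mul_assoc, abs_mul_abs_self] at h2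
  rw [sq]
  linarith [neg_abs_le (W (x₀ + y) - W x₀)]

section APriori

variable {α j : ℝ}

theorem continuous_congestionDensity_comp (hα : 0 < α) {u : ℝ → ℝ} (hu : Continuous u)
    (hpos : ∀ x, 0 < u x) : Continuous fun x => congestionDensity α j (u x) :=
  (continuousOn_congestionDensity hα).comp_continuous hu hpos

theorem integral_one_div_add_mul {a b : ℝ} (ha : 0 < a) (hb : 0 < b) :
    ∫ y in (0 : ℝ)..1, 1 / (a + b * y) = Real.log ((a + b) / a) / b := by
  have hpos : ∀ y ∈ Set.uIcc (0 : ℝ) 1, 0 < a + b * y := by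
    intro y hy
    rw [Set.uIcc_of_le zero_le_one] at hy
    have := mul_nonneg hb.le hy.1
    linarith
  have hd : ∀ y ∈ Set.uIcc (0 : ℝ) 1,
      HasDerivAt (fun y => Real.log (a + b * y) / b) (1 / (a + b * y)) y := by
    intro y hy
    have h1 : HasDerivAt (fun y => a + b * y) b y := by
      simpa using ((hasDerivAt_id y).const_mul b).const_add a
    have h2 := (h1.log (hpos y hy).ne').div_const b
    rwa [div_right_comm, div_self hb.ne'] at h2
  rw [intervalIntegral.integral_eq_sub_of_hasDerivAt hd]
  · rw [Real.log_div (by positivity) ha.ne']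
    simp [sub_div]
  · refine ContinuousOn.intervalIntegrable ?_
    exact continuousOn_const.div (by fun_prop) fun y hy => (hpos y hy).ne'

/-- The mass of the density blows up as `min (H - W) → 0`; this uses `α ≤ 2` and `W ∈ C²`. -/
theorem exists_one_lt_integral_congestionDensity (hα : 0 < α) (hα2 : α ≤ 2) (hj : j ≠ 0) {K : ℝ}
    (hK0 : 0 ≤ K) :
    ∃ δ, 0 < δ ∧ ∀ W : ℝ → ℝ, IsC2Torus W → (∀ x, |deriv (deriv W) x| ≤ K) →
      ∀ H, (∀ x, 0 < H - W x) → (∃ x, H - W x ≤ δ) →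
        1 < ∫ x in (0 : ℝ)..1, congestionDensity α j (H - W x) := by
  obtain ⟨c, hc, hcd⟩ := exists_div_sqrt_le_congestionDensity hα hα2 hj
    (show 0 < K + 1 by positivity)
  set b := √(K + 1) with hb
  have hb0 : 0 < b := by positivity
  -- The exponential makes `log ((a + b) / a) ≥ 2b / c`, so the integral of `c / (a + b y)` is at
  -- least 2. The bound `a ≤ 1` keeps `H - W ≤ a² + K y²` within the range `≤ K + 1` where `c` is
  -- valid.
  set a := min 1 (b * Real.exp (-(2 * b / c))) with ha
  have ha0 : 0 < a := by positivity
  refine ⟨a ^ 2, by positivity, fun W hW hWK H hpos ⟨x₁, hx₁⟩ => ?_⟩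
  obtain ⟨x₀, hmax⟩ := exists_forall_le_of_periodic hW.continuous hW.periodic
  have hx₀ : H - W x₀ ≤ a ^ 2 := by linarith [hmax x₁]
  have ha1 : a ^ 2 ≤ 1 := pow_le_one₀ ha0.le (min_le_left _ _)
  have hWc := hW.continuous
  have hcont : Continuous fun x => congestionDensity α j (H - W x) :=
    continuous_congestionDensity_comp hα (by fun_prop) hpos
  have hshift : ∫ x in (0 : ℝ)..1, congestionDensity α j (H - W x) =
      ∫ y in (0 : ℝ)..1, congestionDensity α j (H - W (x₀ + y)) := by
    have hp : Function.Periodic (fun x => congestionDensity α j (H - W x)) 1 := fun x => by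
      simp only [hW.periodic x]
    rw [intervalIntegral.integral_comp_add_left (fun x => congestionDensity α j (H - W x))]
    simpa using hp.intervalIntegral_add_eq 0 x₀
  have hlow : ∫ y in (0 : ℝ)..1, c * (1 / (a + b * y)) ≤
      ∫ y in (0 : ℝ)..1, congestionDensity α j (H - W (x₀ + y)) := by
    refine intervalIntegral.integral_mono_on zero_le_one ?_
      ((hcont.comp (continuous_const.add continuous_id)).intervalIntegrable _ _) fun y hy => ?_
    · refine ContinuousOn.intervalIntegrable ?_
      refine continuousOn_const.mul (continuousOn_const.div (by fun_prop) fun y hy => ?_)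
      rw [Set.uIcc_of_le zero_le_one] at hy
      have := mul_nonneg hb0.le hy.1
      positivity
    · have h1 := hW.sub_le_mul_sq_of_max hK0 hWK hmax y
      have hy2 : y ^ 2 ≤ 1 := pow_le_one₀ hy.1 hy.2
      have h2 : H - W (x₀ + y) ≤ K + 1 := by nlinarith
      refine le_trans ?_ (hcd _ (hpos _) h2)
      have hby := mul_nonneg hb0.le hy.1
      have hb2 : b ^ 2 = K + 1 := Real.sq_sqrt (by positivity)
      have h3 : √(H - W (x₀ + y)) ≤ a + b * y := by
        refine Real.sqrt_le_iff.2 ⟨by positivity, ?_⟩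
        nlinarith [mul_nonneg ha0.le hby, sq_nonneg y]
      have h4 : 0 < √(H - W (x₀ + y)) := Real.sqrt_pos.2 (hpos _)
      rw [mul_one_div]
      gcongr
  rw [hshift]
  refine lt_of_lt_of_le ?_ hlow
  rw [intervalIntegral.integral_const_mul, integral_one_div_add_mul ha0 hb0]
  have h5 : 2 * b / c ≤ Real.log ((a + b) / a) := by
    rw [Real.le_log_iff_exp_le (by positivity), le_div_iff₀ ha0]
    have h6 : Real.exp (2 * b / c) * a ≤ b := by
      calc Real.exp (2 * b / c) * a ≤
            Real.exp (2 * b / c) * (b * Real.exp (-(2 * b / c))) := by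
            gcongr
            exact min_le_right _ _
        _ = b * (Real.exp (2 * b / c) * Real.exp (-(2 * b / c))) := by ring
        _ = b := by rw [← Real.exp_add]; simp
    linarith
  calc (1 : ℝ) < c * (2 * b / c / b) := by
        have : c * (2 * b / c / b) = 2 := by field_simp
        rw [this]
        norm_num
    _ ≤ _ := by gcongr

theorem exists_integral_congestionDensity_eq_one (hα : 0 < α) (hα2 : α ≤ 2) (hj : j ≠ 0)
    {W : ℝ → ℝ} (hW : IsC2Torus W) :
    ∃ H, (∀ x, 0 < H - W x) ∧ ∫ x in (0 : ℝ)..1, congestionDensity α j (H - W x) = 1 := by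
  obtain ⟨K, hK0, hK⟩ := hW.exists_abs_deriv_deriv_le
  obtain ⟨δ, hδ, hblow⟩ := exists_one_lt_integral_congestionDensity hα hα2 hj hK0
  obtain ⟨x₀, hmax⟩ := exists_forall_le_of_periodic hW.continuous hW.periodic
  have hWc := hW.continuous
  have hj2 : 0 < j ^ 2 / 2 := by positivity
  -- Endpoints for the intermediate value theorem: at `max W + e` the mass exceeds one because `e ≤
  -- δ`; at `max W + j²/2` the density is at most one everywhere.
  set e := min δ (j ^ 2 / 2) with he
  have he0 : 0 < e := lt_min hδ hj2
  -- Truncation at `e` makes the mass continuous in `H` on the whole line and changes nothing for `H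
  -- ≥ max W + e`.
  set Φ : ℝ → ℝ := fun H => ∫ x in (0 : ℝ)..1, congestionDensity α j (max (H - W x) e) with hΦ
  have hΦc : Continuous Φ := by
    refine intervalIntegral.continuous_parametric_intervalIntegral_of_continuous' ?_ _ _
    exact (continuousOn_congestionDensity hα).comp_continuous (by fun_prop)
      fun p => lt_max_of_lt_right he0
  have heq (H : ℝ) (hH : W x₀ + e ≤ H) :
      Φ H = ∫ x in (0 : ℝ)..1, congestionDensity α j (H - W x) := by
    simp only [hΦ]
    congr 1
    ext x
    rw [max_eq_left]
    linarith [hmax x]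
  have hle : W x₀ + e ≤ W x₀ + j ^ 2 / 2 := by
    gcongr
    exact min_le_right _ _
  have h1 : 1 ≤ Φ (W x₀ + e) := by
    rw [heq _ le_rfl]
    refine (hblow W hW hK _ (fun x => by linarith [hmax x]) ⟨x₀, ?_⟩).le
    rw [add_sub_cancel_left]
    exact min_le_left _ _
  have hone : congestionDensity α j (j ^ 2 / 2) = 1 := by
    rw [congestionDensity, mul_div_cancel₀ _ two_ne_zero, div_self (by positivity),
      Real.one_rpow]
  have h2 : Φ (W x₀ + j ^ 2 / 2) ≤ 1 := by
    rw [heq _ hle]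
    have hpos : ∀ x, 0 < W x₀ + j ^ 2 / 2 - W x := fun x => by linarith [hmax x]
    have : ∫ x in (0 : ℝ)..1, congestionDensity α j (W x₀ + j ^ 2 / 2 - W x) ≤
        ∫ x in (0 : ℝ)..1, (1 : ℝ) := by
      refine intervalIntegral.integral_mono_on zero_le_one
        ((continuous_congestionDensity_comp hα (by fun_prop) hpos).intervalIntegrable _ _)
        (by simp) fun x _ => ?_
      rw [← hone]
      exact congestionDensity_anti hα hj2 (by linarith [hmax x])
    simpa using this
  obtain ⟨H, hH, hH1⟩ := intermediate_value_Icc' hle hΦc.continuousOn ⟨h2, h1⟩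
  refine ⟨H, fun x => by linarith [hmax x, hH.1], ?_⟩
  rw [← heq H hH.1, hH1]

end APriori

/-! ### Stability of solutions -/

/-- The slope of `s ↦ j² / (2 s^α)` is negative and smallest in size at `s = M`, where its size is
`l`; so adding `l s` leaves the function nonincreasing on `(0, M]`. -/
theorem exists_strong_anti_rpow {α j : ℝ} (hα : 0 < α) (hj : j ≠ 0) {M : ℝ} (hM : 0 < M) :
    ∃ l, 0 < l ∧ ∀ a b, 0 < a → a ≤ M → 0 < b → b ≤ M →
      l * |a - b| ≤ |j ^ 2 / (2 * a ^ α) - j ^ 2 / (2 * b ^ α)| ∧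
      (j ^ 2 / (2 * a ^ α) - j ^ 2 / (2 * b ^ α)) * (a - b) ≤ -(l * (a - b) ^ 2) := by
  set l := j ^ 2 / 2 * α * M ^ (-α - 1) with hl
  have hl0 : 0 < l := by positivity
  have hd (x : ℝ) (hx : 0 < x) : HasDerivAt (fun x => j ^ 2 / 2 * x ^ (-α) + l * x)
      (j ^ 2 / 2 * (-α * x ^ (-α - 1)) + l) x := by
    have h1 := (Real.hasDerivAt_rpow_const (p := -α) (Or.inl hx.ne')).const_mul (j ^ 2 / 2)
    have h2 := (hasDerivAt_id x).const_mul l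
    simpa using h1.fun_add h2
  have hanti : AntitoneOn (fun x => j ^ 2 / 2 * x ^ (-α) + l * x) (Set.Ioc 0 M) := by
    refine antitoneOn_of_deriv_nonpos (convex_Ioc 0 M)
      (fun x hx => (hd x hx.1).continuousAt.continuousWithinAt) ?_ ?_
    · intro x hx
      rw [interior_Ioc] at hx
      exact (hd x hx.1).differentiableAt.differentiableWithinAt
    · intro x hx
      rw [interior_Ioc] at hx
      rw [(hd x hx.1).deriv]
      have h1 : M ^ (-α - 1) ≤ x ^ (-α - 1) :=
        Real.rpow_le_rpow_of_nonpos hx.1 hx.2.le (by linarith)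
      have h2 : l ≤ j ^ 2 / 2 * α * x ^ (-α - 1) := by
        rw [hl]
        gcongr
      linarith
  have key (a b : ℝ) (ha : 0 < a) (hab : a ≤ b) (hb : b ≤ M) :
      l * (b - a) ≤ j ^ 2 / (2 * a ^ α) - j ^ 2 / (2 * b ^ α) := by
    have h := hanti ⟨ha, hab.trans hb⟩ ⟨ha.trans_le hab, hb⟩ hab
    dsimp only at h
    rw [Real.rpow_neg ha.le, Real.rpow_neg (ha.trans_le hab).le] at h
    have e1 (t : ℝ) : j ^ 2 / (2 * t) = j ^ 2 / 2 * t⁻¹ := by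
      rw [div_mul_eq_div_div, div_eq_mul_inv]
    rw [e1, e1]
    linarith
  refine ⟨l, hl0, fun a b ha haM hb hbM => ?_⟩
  rcases le_total a b with hab | hab
  · have h := key a b ha hab hbM
    have h0 : 0 ≤ l * (b - a) := mul_nonneg hl0.le (by linarith)
    constructor
    · rw [abs_of_nonneg (h0.trans h), abs_sub_comm, abs_of_nonneg (by linarith)]
      exact h
    · nlinarith
  · have h := key b a hb hab haM
    have h0 : 0 ≤ l * (a - b) := mul_nonneg hl0.le (by linarith)
    constructor
    · rw [abs_sub_comm (j ^ 2 / _), abs_of_nonneg (h0.trans h), abs_of_nonneg (by linarith)]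
      exact h
    · nlinarith

theorem sq_integral_abs_le {h : ℝ → ℝ} (hc : Continuous h) :
    (∫ x in (0 : ℝ)..1, |h x|) ^ 2 ≤ ∫ x in (0 : ℝ)..1, h x ^ 2 := by
  set a := ∫ x in (0 : ℝ)..1, |h x| with ha
  have h1 : 0 ≤ ∫ x in (0 : ℝ)..1, (|h x| - a) ^ 2 :=
    intervalIntegral.integral_nonneg zero_le_one fun x _ => sq_nonneg _
  have h2 (x : ℝ) : (|h x| - a) ^ 2 = h x ^ 2 - 2 * a * |h x| + a ^ 2 := by
    rw [sub_sq, sq_abs]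
    ring
  simp only [h2] at h1
  rw [intervalIntegral.integral_add ((by fun_prop : Continuous _).intervalIntegrable _ _)
    (by simp), intervalIntegral.integral_sub
    ((by fun_prop : Continuous _).intervalIntegrable _ _)
    ((by fun_prop : Continuous _).intervalIntegrable _ _),
    intervalIntegral.integral_const_mul, ← ha] at h1
  simp only [intervalIntegral.integral_const, sub_zero, one_smul] at h1
  linarith

theorem exists_eq_zero_of_integral_eq_zero {h : ℝ → ℝ} (hc : Continuous h)
    (h0 : ∫ x in (0 : ℝ)..1, h x = 0) : ∃ x, h x = 0 := by
  by_contra! hne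
  have hpos : (∀ x, 0 < h x) ∨ ∀ x, h x < 0 := by
    by_contra! hcon
    obtain ⟨⟨x, hx⟩, y, hy⟩ := hcon
    obtain ⟨z, hz⟩ := mem_range_of_exists_le_of_exists_ge hc ⟨x, hx⟩ ⟨y, hy⟩
    exact hne z hz
  rcases hpos with hp | hp
  · exact (intervalIntegral.intervalIntegral_pos_of_pos (hc.intervalIntegrable 0 1) hp
      zero_lt_one).ne' h0
  · have := intervalIntegral.intervalIntegral_pos_of_pos (f := fun x => -h x)
      (hc.neg.intervalIntegrable 0 1) (fun x => by linarith [hp x]) zero_lt_one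
    rw [intervalIntegral.integral_neg, h0] at this
    simp at this

/-- Solutions depend in a Lipschitz way on the potential, uniformly over monotone kernels bounded
by `g` and densities bounded by `M`. -/
theorem exists_stability_const {α j : ℝ} (hα : 0 < α) (hj : j ≠ 0) {g M : ℝ} (hg0 : 0 ≤ g)
    (hM : 0 < M) :
    ∃ C, 0 ≤ C ∧ ∀ G m₁ m₂ W₁ W₂ : ℝ → ℝ, ∀ H₁ H₂ d : ℝ,
      Continuous G → IsMonotoneKernel G → (∀ x, |G x| ≤ g) →
      Continuous m₁ → Continuous m₂ → Function.Periodic m₁ 1 → Function.Periodic m₂ 1 →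
      (∀ x, 0 < m₁ x) → (∀ x, 0 < m₂ x) → (∀ x, m₁ x ≤ M) → (∀ x, m₂ x ≤ M) →
      ∫ x in (0 : ℝ)..1, m₁ x = 1 → ∫ x in (0 : ℝ)..1, m₂ x = 1 →
      Continuous W₁ → Continuous W₂ → (∀ x, |W₁ x - W₂ x| ≤ d) →
      (∀ x, j ^ 2 / (2 * m₁ x ^ α) + W₁ x = torusConv G m₁ x + H₁) →
      (∀ x, j ^ 2 / (2 * m₂ x ^ α) + W₂ x = torusConv G m₂ x + H₂) →
      (∀ x, |m₁ x - m₂ x| ≤ C * d) ∧ |H₁ - H₂| ≤ C * d := by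
  obtain ⟨l, hl, hanti⟩ := exists_strong_anti_rpow hα hj hM
  refine ⟨max (2 * (1 + g / l) / l) (1 + g / l), by positivity, ?_⟩
  intro G m₁ m₂ W₁ W₂ H₁ H₂ d hG hmon hg c1 c2 p1 p2 pos1 pos2 le1 le2 i1 i2 w1 w2 hd e1 e2
  have hd0 : 0 ≤ d := (abs_nonneg _).trans (hd 0)
  set h : ℝ → ℝ := fun x => m₁ x - m₂ x with hh
  have hc : Continuous h := c1.sub c2
  have hconv (x : ℝ) : torusConv G h x = torusConv G m₁ x - torusConv G m₂ x :=
    torusConv_sub_right hG c1 c2 x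
  have hGh := continuous_torusConv hG hc
  have hint : ∫ x in (0 : ℝ)..1, h x = 0 := by
    simp only [hh]
    rw [intervalIntegral.integral_sub (c1.intervalIntegrable 0 1) (c2.intervalIntegrable 0 1), i1,
      i2, sub_self]
  -- Multiply the difference of the equations by `h` and integrate: the kernel term is nonnegative
  -- and the term with `H₁ - H₂` vanishes as `∫ h = 0`.
  have hl1 : l * (∫ x in (0 : ℝ)..1, h x ^ 2) ≤ d * ∫ x in (0 : ℝ)..1, |h x| := by
    have hq := isMonotoneKernel_iff.1 hmon h hc (p1.sub p2)
    have hpt (x : ℝ) : torusConv G h x * h x + (H₁ - H₂) * h x + l * h x ^ 2 ≤ d * |h x| := by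
      have h1 := (hanti _ _ (pos1 x) (le1 x) (pos2 x) (le2 x)).2
      have h2 : (W₁ x - W₂ x) * h x ≤ d * |h x| := by
        refine (le_abs_self _).trans ?_
        rw [abs_mul]
        exact mul_le_mul_of_nonneg_right (hd x) (abs_nonneg _)
      have h3 : (j ^ 2 / (2 * m₁ x ^ α) - j ^ 2 / (2 * m₂ x ^ α)) =
          torusConv G h x + (H₁ - H₂) - (W₁ x - W₂ x) := by
        rw [hconv]
        linarith [e1 x, e2 x]
      rw [h3] at h1
      change (_ - _) * h x ≤ -(l * h x ^ 2) at h1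
      linarith
    have h4 := intervalIntegral.integral_mono_on (μ := MeasureTheory.volume) zero_le_one
      ((by fun_prop : Continuous fun x =>
        torusConv G h x * h x + (H₁ - H₂) * h x + l * h x ^ 2).intervalIntegrable _ _)
      ((by fun_prop : Continuous fun x => d * |h x|).intervalIntegrable _ _) fun x _ => hpt x
    rw [intervalIntegral.integral_add ((by fun_prop : Continuous _).intervalIntegrable _ _)
      ((by fun_prop : Continuous _).intervalIntegrable _ _),
      intervalIntegral.integral_add ((by fun_prop : Continuous _).intervalIntegrable _ _)
      ((by fun_prop : Continuous _).intervalIntegrable _ _),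
      intervalIntegral.integral_const_mul, intervalIntegral.integral_const_mul,
      intervalIntegral.integral_const_mul, hint] at h4
    linarith
  set a := ∫ x in (0 : ℝ)..1, |h x| with ha
  have ha0 : 0 ≤ a := intervalIntegral.integral_nonneg zero_le_one fun x _ => abs_nonneg _
  -- Cauchy–Schwarz turns the L² estimate into an L¹ one, which suffices to bound the convolution `G
  -- * h` uniformly.
  have had : a ≤ d / l := by
    rw [le_div_iff₀ hl]
    rcases ha0.eq_or_lt with h0 | h0
    · rw [← h0]
      simpa using hd0
    · have := mul_le_mul_of_nonneg_left (sq_integral_abs_le hc) hl.le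
      rw [← ha] at this
      have h5 : a * (a * l) ≤ a * d := by nlinarith
      exact le_of_mul_le_mul_left h5 h0
  have hcb (x : ℝ) : |torusConv G h x| ≤ g * (d / l) :=
    (abs_torusConv_le hG hc hg x).trans (by gcongr)
  have hdH : |H₁ - H₂| ≤ (1 + g / l) * d := by
    -- Equal masses force the densities to agree somewhere; there the congestion terms cancel and
    -- `H₁ - H₂` can be read off.
    obtain ⟨x₀, hx₀⟩ := exists_eq_zero_of_integral_eq_zero hc hint
    have heq : m₁ x₀ = m₂ x₀ := sub_eq_zero.1 hx₀
    have h6 : H₁ - H₂ = (W₁ x₀ - W₂ x₀) - torusConv G h x₀ := by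
      have := e1 x₀
      rw [heq] at this
      rw [hconv]
      linarith [e2 x₀]
    rw [h6]
    calc _ ≤ |W₁ x₀ - W₂ x₀| + |torusConv G h x₀| := abs_sub _ _
      _ ≤ d + g * (d / l) := add_le_add (hd _) (hcb _)
      _ = _ := by ring
  refine ⟨fun x => ?_, hdH.trans (by gcongr; exact le_max_right _ _)⟩
  have h7 := (hanti _ _ (pos1 x) (le1 x) (pos2 x) (le2 x)).1
  have h8 : (j ^ 2 / (2 * m₁ x ^ α) - j ^ 2 / (2 * m₂ x ^ α)) =
      torusConv G h x + (H₁ - H₂) - (W₁ x - W₂ x) := by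
    rw [hconv]
    linarith [e1 x, e2 x]
  have h9 : |torusConv G h x + (H₁ - H₂) - (W₁ x - W₂ x)| ≤ 2 * (1 + g / l) * d := by
    calc _ ≤ |torusConv G h x + (H₁ - H₂)| + |W₁ x - W₂ x| := abs_sub _ _
      _ ≤ |torusConv G h x| + |H₁ - H₂| + |W₁ x - W₂ x| := by gcongr; exact abs_add_le _ _
      _ ≤ g * (d / l) + (1 + g / l) * d + d := by gcongr <;> [exact hcb x; exact hd x]
      _ = _ := by ring
  rw [h8] at h7
  calc |m₁ x - m₂ x| ≤ 2 * (1 + g / l) * d / l := by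
        rw [le_div_iff₀ hl, mul_comm]
        exact h7.trans h9
    _ = 2 * (1 + g / l) / l * d := by ring
    _ ≤ _ := by gcongr; exact le_max_left _ _

/-! ### Existence and uniqueness -/

section Existence

variable {α j : ℝ}

theorem exists_lt_sub_of_solution (hα : 0 < α) (hα2 : α ≤ 2) (hj : j ≠ 0) {K : ℝ} (hK : 0 ≤ K) :
    ∃ δ, 0 < δ ∧ ∀ W m : ℝ → ℝ, ∀ H : ℝ, IsC2Torus W → (∀ x, |deriv (deriv W) x| ≤ K) →
      (∀ x, 0 < m x) → ∫ x in (0 : ℝ)..1, m x = 1 →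
      (∀ x, j ^ 2 / (2 * m x ^ α) + W x = H) →
      (∀ x, m x = congestionDensity α j (H - W x)) ∧ ∀ x, δ < H - W x := by
  obtain ⟨δ, hδ, h⟩ := exists_one_lt_integral_congestionDensity hα hα2 hj hK
  refine ⟨δ, hδ, fun W m H hW hWK hm h1 heq => ?_⟩
  have hpos (x : ℝ) : 0 < H - W x := by
    have h2 : 0 < j ^ 2 / (2 * m x ^ α) := by
      have := Real.rpow_pos_of_pos (hm x) α
      positivity
    linarith [heq x]
  have hmd (x : ℝ) : m x = congestionDensity α j (H - W x) :=
    (eq_congestionDensity_iff hα hj (hm x) (hpos x)).2 (by linarith [heq x])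
  refine ⟨hmd, ?_⟩
  by_contra! hx
  have h3 := h W hW hWK H hpos hx
  simp only [← hmd, h1, lt_irrefl] at h3

/-- Both derivatives fall on `G`, and `m` has mass one, so the bound does not see `m`. This is what
makes the a priori estimate uniform over all solutions. -/
theorem abs_deriv_deriv_sub_torusConv_le {V G m : ℝ → ℝ} {KV KG : ℝ} (hV : IsC2Torus V)
    (hG : IsC2Torus G) (hVK : ∀ x, |deriv (deriv V) x| ≤ KV)
    (hGK : ∀ x, |deriv (deriv G) x| ≤ KG) (hm : Continuous m) (hm0 : ∀ x, 0 ≤ m x)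
    (hm1 : ∫ x in (0 : ℝ)..1, m x = 1) (x : ℝ) :
    |deriv (deriv fun x => V x - torusConv G m x) x| ≤ KV + KG := by
  rw [hV.deriv_deriv_sub (hG.torusConv hm), hG.deriv_deriv_torusConv hm]
  refine (abs_sub _ _).trans (add_le_add (hVK x) ?_)
  exact abs_torusConv_le_of_density hG.continuous_deriv_deriv hm hGK hm0 hm1 x

theorem exists_lt_of_isSolution (hα : 0 < α) (hα2 : α ≤ 2) (hj : j ≠ 0) {KV KG : ℝ}
    (hKV : 0 ≤ KV) (hKG : 0 ≤ KG) :
    ∃ δ, 0 < δ ∧ ∀ V G m : ℝ → ℝ, ∀ H : ℝ, IsC2Torus V → IsC2Torus G →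
      (∀ x, |deriv (deriv V) x| ≤ KV) → (∀ x, |deriv (deriv G) x| ≤ KG) →
      IsSolution α j V G m H →
      (∀ x, m x = congestionDensity α j (H - (V x - torusConv G m x))) ∧
      (∀ x, δ < H - (V x - torusConv G m x)) ∧ ∀ x, m x ≤ congestionDensity α j δ := by
  obtain ⟨δ, hδ, h⟩ := exists_lt_sub_of_solution hα hα2 hj (add_nonneg hKV hKG)
  refine ⟨δ, hδ, fun V G m H hV hG hVK hGK hm => ?_⟩
  have hmc := hm.smooth.continuous
  obtain ⟨h1, h2⟩ := h (fun x => V x - torusConv G m x) m H (hV.sub (hG.torusConv hmc))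
    (abs_deriv_deriv_sub_torusConv_le hV hG hVK hGK hmc (fun x => (hm.pos x).le) hm.mass)
    hm.pos hm.mass fun x => by
      have := hm.eqn x
      simp only [torusConv]
      linarith
  refine ⟨h1, h2, fun x => ?_⟩
  rw [h1]
  exact congestionDensity_anti hα hδ (h2 x).le

theorem exists_isSolution_zero_mul (hα : 0 < α) (hα2 : α ≤ 2) (hj : j ≠ 0) {V : ℝ → ℝ}
    (G : ℝ → ℝ) (hV : IsC2Torus V) : ∃ m H, IsSolution α j V (fun x => 0 * G x) m H := by
  obtain ⟨H, hpos, h1⟩ := exists_integral_congestionDensity_eq_one hα hα2 hj hV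
  refine ⟨fun x => congestionDensity α j (H - V x), H, ⟨?_, fun x => ?_⟩,
    fun x => congestionDensity_pos hj (hpos x), h1, fun x => ?_⟩
  · exact contDiff_congestionDensity_comp hj (contDiff_const.sub hV.contDiff) hpos
  · simp only [hV.periodic x]
  · rw [(eq_congestionDensity_iff hα hj (congestionDensity_pos hj (hpos x)) (hpos x)).1 rfl]
    simp

/-- The set of continuous probability densities on the torus, in the sup norm. -/
def torusDensities : Set (BoundedContinuousFunction ℝ ℝ) :=
  {n | (∀ x, n (x + 1) = n x) ∧ (∀ x, 0 ≤ n x) ∧ ∫ x in (0 : ℝ)..1, n x = 1}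

/-- Closedness gives the completeness needed for the fixed point, and is why only `0 ≤ n x` is
asked; strict positivity comes back from the equation. -/
theorem isClosed_torusDensities : IsClosed torusDensities := by
  have hev (x : ℝ) : Continuous fun n : BoundedContinuousFunction ℝ ℝ => n x :=
    continuous_eval_const x
  simp only [torusDensities, Set.ofPred_and, Set.ofPred_forall]
  refine IsClosed.inter (isClosed_iInter fun x => isClosed_eq (hev _) (hev _))
    (IsClosed.inter (isClosed_iInter fun x => isClosed_le continuous_const (hev x)) ?_)
  refine isClosed_eq ?_ continuous_const
  refine intervalIntegral.continuous_parametric_intervalIntegral_of_continuous' ?_ _ _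
  exact continuous_eval

/-- One step of the continuation in the coupling strength `t`. -/
theorem exists_continuation_step (hα : 0 < α) (hα2 : α ≤ 2) (hj : j ≠ 0) {G : ℝ → ℝ}
    (hG : IsC2Torus G) (hmon : IsMonotoneKernel G) {K KG : ℝ} (hK : 0 ≤ K) (hKG : 0 ≤ KG)
    (hGK : ∀ x, |deriv (deriv G) x| ≤ KG) :
    ∃ ε, 0 < ε ∧ ∀ t e, 0 ≤ t → 0 ≤ e → e ≤ ε → t + e ≤ 1 →
      (∀ V, IsC2Torus V → (∀ x, |deriv (deriv V) x| ≤ K + (1 - t) * KG) →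
        ∃ m H, IsSolution α j V (fun x => t * G x) m H) →
      ∀ V, IsC2Torus V → (∀ x, |deriv (deriv V) x| ≤ K + (1 - (t + e)) * KG) →
        ∃ m H, IsSolution α j V (fun x => (t + e) * G x) m H := by
  obtain ⟨g, hg0, hg⟩ := exists_abs_le_of_periodic hG.continuous hG.periodic
  obtain ⟨δ, hδ, hap⟩ := exists_lt_of_isSolution hα hα2 hj (add_nonneg hK hKG) hKG
  obtain ⟨C, hC0, hstab⟩ := exists_stability_const hα hj hg0 (congestionDensity_pos (α := α) hj hδ)
  -- The step length makes the Lipschitz constant `C * (e * g)` at most `1/2`. It depends only on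
  -- the uniform constants `C` and `g`, not on `t` or `V`.
  refine ⟨1 / (2 * (C * g + 1)), by positivity, fun t e ht he hle hte hsolv V hV hVK => ?_⟩
  have hGc := hG.continuous
  have ht1 : t ≤ 1 := by linarith
  have hcontr : C * (e * g) ≤ 1 / 2 := by
    rw [le_div_iff₀ (by positivity)] at hle
    nlinarith [mul_nonneg hC0 hg0]
  have htGK (x : ℝ) : |deriv (deriv fun x => t * G x) x| ≤ KG := by
    rw [IsC2Torus.deriv_deriv_const_mul, abs_mul, abs_of_nonneg ht]
    exact (mul_le_of_le_one_left (abs_nonneg _) ht1).trans (hGK x)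
  have htg (x : ℝ) : |t * G x| ≤ g := by
    rw [abs_mul, abs_of_nonneg ht]
    exact (mul_le_of_le_one_left (abs_nonneg _) ht1).trans (hg x)
  -- The increment `e G` of the kernel, applied to a given density `n`, is moved into the potential.
  -- A fixed point of `n ↦` solution with kernel `t G` and potential `U n` solves the problem with
  -- kernel `(t + e) G`.
  set U : BoundedContinuousFunction ℝ ℝ → ℝ → ℝ :=
    fun n x => V x - torusConv (fun x => e * G x) n x with hU
  have hUC2 (n : BoundedContinuousFunction ℝ ℝ) : IsC2Torus (U n) :=
    hV.sub ((hG.const_mul e).torusConv n.continuous)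
  -- The allowance `(1 - t) * KG` for the potential is a budget: a step of length `e` costs `e *
  -- KG`, and all bounds stay below `K + KG`.
  have hUK (n) (hn : n ∈ torusDensities) (x : ℝ) :
      |deriv (deriv (U n)) x| ≤ K + (1 - t) * KG := by
    have := abs_deriv_deriv_sub_torusConv_le (KG := e * KG) hV (hG.const_mul e) hVK (fun x => by
      rw [IsC2Torus.deriv_deriv_const_mul, abs_mul, abs_of_nonneg he]
      exact mul_le_mul_of_nonneg_left (hGK x) he) n.continuous hn.2.1 hn.2.2 x
    linarith
  have hex : ∀ n : BoundedContinuousFunction ℝ ℝ, ∃ n' : BoundedContinuousFunction ℝ ℝ,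
      n ∈ torusDensities → n' ∈ torusDensities ∧
        ∃ H, IsSolution α j (U n) (fun x => t * G x) n' H := by
    intro n
    by_cases hn : n ∈ torusDensities
    · obtain ⟨m, H, hm⟩ := hsolv (U n) (hUC2 n) (hUK n hn)
      obtain ⟨B, -, hB⟩ := exists_abs_le_of_periodic hm.smooth.continuous hm.smooth.periodic
      exact ⟨.ofNormedAddCommGroup m hm.smooth.continuous B hB,
        fun _ => ⟨⟨hm.smooth.periodic, fun x => (hm.pos x).le, hm.mass⟩, H, hm⟩⟩
    -- An arbitrary value off the densities makes `Φ` a total function.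
    · exact ⟨n, fun h => absurd h hn⟩
  choose Φ hΦ using hex
  have hmaps : Set.MapsTo Φ torusDensities torusDensities := fun n hn => (hΦ n hn).1
  have hdist (n₁ n₂) (h₁ : n₁ ∈ torusDensities) (h₂ : n₂ ∈ torusDensities) :
      dist (Φ n₁) (Φ n₂) ≤ 1 / 2 * dist n₁ n₂ := by
    obtain ⟨-, H₁, s₁⟩ := hΦ n₁ h₁
    obtain ⟨-, H₂, s₂⟩ := hΦ n₂ h₂
    rw [BoundedContinuousFunction.dist_le (by positivity)]
    intro x
    have hKt : K + (1 - t) * KG ≤ K + KG := by nlinarith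
    have hd (x : ℝ) : |U n₁ x - U n₂ x| ≤ e * g * dist n₁ n₂ := by
      have e1 : U n₁ x - U n₂ x = -torusConv (fun x => e * G x) (fun x => n₁ x - n₂ x) x := by
        rw [torusConv_sub_right (by fun_prop) n₁.continuous n₂.continuous]
        simp only [hU]
        ring
      rw [e1, abs_neg]
      refine (abs_torusConv_le (g := e * g) (by fun_prop) (by fun_prop) (fun x => ?_) x).trans ?_
      · rw [abs_mul, abs_of_nonneg he]
        exact mul_le_mul_of_nonneg_left (hg x) he
      · have : ∫ x in (0 : ℝ)..1, |n₁ x - n₂ x| ≤ ∫ x in (0 : ℝ)..1, dist n₁ n₂ :=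
          intervalIntegral.integral_mono_on zero_le_one
            ((by fun_prop : Continuous fun x => |n₁ x - n₂ x|).intervalIntegrable _ _) (by simp)
            fun x _ => by
              rw [← Real.dist_eq]
              exact BoundedContinuousFunction.dist_coe_le_dist x
        simp only [intervalIntegral.integral_const, sub_zero, one_smul] at this
        gcongr
    have := (hstab (fun x => t * G x) (Φ n₁) (Φ n₂) (U n₁) (U n₂) H₁ H₂ (e * g * dist n₁ n₂)
      (by fun_prop) (hmon.const_mul ht) htg s₁.smooth.continuous s₂.smooth.continuous
      s₁.smooth.periodic s₂.smooth.periodic s₁.pos s₂.pos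
      (hap _ _ _ _ (hUC2 n₁) (hG.const_mul t) (fun x => (hUK n₁ h₁ x).trans hKt) htGK s₁).2.2
      (hap _ _ _ _ (hUC2 n₂) (hG.const_mul t) (fun x => (hUK n₂ h₂ x).trans hKt) htGK s₂).2.2
      s₁.mass s₂.mass (hUC2 n₁).continuous (hUC2 n₂).continuous hd s₁.eqn s₂.eqn).1 x
    rw [Real.dist_eq]
    calc _ ≤ C * (e * g * dist n₁ n₂) := this
      _ = C * (e * g) * dist n₁ n₂ := by ring
      _ ≤ _ := by gcongr
  have hcw : ContractingWith (1 / 2) (hmaps.restrict Φ torusDensities torusDensities) := by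
    refine ⟨by rw [← NNReal.coe_lt_coe]; norm_num, LipschitzWith.of_dist_le_mul fun a b => ?_⟩
    have := hdist a b a.2 b.2
    simpa [Subtype.dist_eq] using this
  obtain ⟨n, hn, hfix, -⟩ := hcw.exists_fixedPoint' isClosed_torusDensities.isComplete hmaps
    (x := BoundedContinuousFunction.const ℝ 1) ⟨by simp, by simp, by simp⟩ (edist_ne_top _ _)
  obtain ⟨-, H, hs⟩ := hΦ n hn
  rw [hfix] at hs
  refine ⟨n, H, hs.smooth, hs.pos, hs.mass, fun x => ?_⟩
  have h1 : j ^ 2 / (2 * n x ^ α) + (V x - torusConv (fun x => e * G x) n x) =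
    torusConv (fun x => t * G x) n x + H := hs.eqn x
  change _ = torusConv (fun x => (t + e) * G x) n x + H
  rw [torusConv_const_mul_left, torusConv_const_mul_left] at h1
  rw [torusConv_const_mul_left]
  linarith

theorem exists_isSolution (hα : 0 < α) (hα2 : α ≤ 2) (hj : j ≠ 0) {V G : ℝ → ℝ}
    (hV : IsC2Torus V) (hG : IsC2Torus G) (hmon : IsMonotoneKernel G) :
    ∃ m H, IsSolution α j V G m H := by
  obtain ⟨K, hK0, hK⟩ := hV.exists_abs_deriv_deriv_le
  obtain ⟨KG, hKG0, hKG⟩ := hG.exists_abs_deriv_deriv_le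
  obtain ⟨ε, hε, hstep⟩ := exists_continuation_step hα hα2 hj hG hmon hK0 hKG0 hKG
  obtain ⟨N, hN⟩ := exists_nat_one_div_lt hε
  have hN0 : (0 : ℝ) < N + 1 := by positivity
  -- The induction must range over all potentials within the budget, because each step solves the
  -- previous problem with modified potentials. After `N + 1` steps the budget has shrunk to `K`,
  -- the bound for the given `V`.
  have hind (k : ℕ) (hk : k ≤ N + 1) : ∀ V, IsC2Torus V →
      (∀ x, |deriv (deriv V) x| ≤ K + (1 - k * (1 / ((N : ℝ) + 1))) * KG) →
      ∃ m H, IsSolution α j V (fun x => k * (1 / ((N : ℝ) + 1)) * G x) m H := by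
    induction k with
    | zero =>
      intro V hV _
      simpa using exists_isSolution_zero_mul hα hα2 hj G hV
    | succ k ih =>
      have hk' : ((k : ℝ) + 1) ≤ N + 1 := by exact_mod_cast hk
      have := hstep (k * (1 / ((N : ℝ) + 1))) (1 / ((N : ℝ) + 1)) (by positivity) (by positivity)
        hN.le (by
          rw [← add_one_mul, mul_one_div]
          exact (div_le_one hN0).2 hk') (ih (by omega))
      rw [← add_one_mul] at this
      push_cast
      exact this
  have h1 : ((N + 1 : ℕ) : ℝ) * (1 / ((N : ℝ) + 1)) = 1 := by
    push_cast
    field_simp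
  have := hind (N + 1) le_rfl V hV
  simp only [h1, sub_self, zero_mul, add_zero, one_mul] at this
  exact this hK

theorem IsSolution.isUniqueSolution (hα : 0 < α) (hj : j ≠ 0) {V G m : ℝ → ℝ} {H : ℝ}
    (hV : IsC2Torus V) (hG : IsC2Torus G) (hmon : IsMonotoneKernel G)
    (h : IsSolution α j V G m H) : IsUniqueSolution α j V G m H := by
  refine ⟨h, fun m' H' h' => ?_⟩
  obtain ⟨g, hg0, hg⟩ := exists_abs_le_of_periodic hG.continuous hG.periodic
  obtain ⟨B, hB0, hB⟩ := exists_abs_le_of_periodic h.smooth.continuous h.smooth.periodic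
  obtain ⟨B', -, hB'⟩ := exists_abs_le_of_periodic h'.smooth.continuous h'.smooth.periodic
  -- Only two solutions are compared, so their own sup bounds serve as `M`; the `+ 1` makes it
  -- positive. Stability is then used with `d = 0`.
  obtain ⟨C, -, hC⟩ := exists_stability_const (M := max B B' + 1) hα hj hg0
    (by have := hB0.trans (le_max_left B B'); linarith)
  obtain ⟨h1, h2⟩ := hC G m' m V V H' H 0 hG.continuous hmon hg h'.smooth.continuous
    h.smooth.continuous h'.smooth.periodic h.smooth.periodic h'.pos h.pos
    (fun x => by linarith [(le_abs_self _).trans (hB' x), le_max_right B B'])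
    (fun x => by linarith [(le_abs_self _).trans (hB x), le_max_left B B'])
    h'.mass h.mass hV.continuous hV.continuous (by simp) h'.eqn h.eqn
  simp only [mul_zero, abs_nonpos_iff, sub_eq_zero] at h1 h2
  exact ⟨funext h1, h2⟩

end Existence

/-! ### Uniform convergence -/

section Uniform

theorem tendstoUniformly_iff_abs {f : ℕ → ℝ → ℝ} {g : ℝ → ℝ} :
    TendstoUniformly f g atTop ↔ ∀ ε > 0, ∀ᶠ n in atTop, ∀ x, |f n x - g x| ≤ ε := by
  rw [Metric.tendstoUniformly_iff]
  constructor
  · intro h ε hε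
    filter_upwards [h ε hε] with n hn x
    rw [← Real.dist_eq, dist_comm]
    exact (hn x).le
  · intro h ε hε
    filter_upwards [h (ε / 2) (half_pos hε)] with n hn x
    rw [dist_comm, Real.dist_eq]
    linarith [hn x]

theorem TendstoUniformly.mul_of_bounded {f₁ f₂ : ℕ → ℝ → ℝ} {g₁ g₂ : ℝ → ℝ} {B₁ B₂ : ℝ}
    (h₁ : TendstoUniformly f₁ g₁ atTop) (h₂ : TendstoUniformly f₂ g₂ atTop)
    (hB₁ : ∀ x, |g₁ x| ≤ B₁) (hB₂ : ∀ x, |g₂ x| ≤ B₂) :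
    TendstoUniformly (fun n x => f₁ n x * f₂ n x) (fun x => g₁ x * g₂ x) atTop := by
  have hb1 : 0 ≤ B₁ := (abs_nonneg _).trans (hB₁ 0)
  have hb2 : 0 ≤ B₂ := (abs_nonneg _).trans (hB₂ 0)
  rw [tendstoUniformly_iff_abs] at *
  intro ε hε
  set e := min 1 (ε / (1 + B₁ + B₂)) with he
  have he0 : 0 < e := by positivity
  filter_upwards [h₁ e he0, h₂ e he0] with n hn1 hn2 x
  have h3 : f₁ n x * f₂ n x - g₁ x * g₂ x =
      (f₁ n x - g₁ x) * (f₂ n x - g₂ x) + (f₁ n x - g₁ x) * g₂ x + g₁ x * (f₂ n x - g₂ x) := by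
    ring
  have h4 : e * (1 + B₁ + B₂) ≤ ε := by
    rw [← le_div_iff₀ (by positivity)]
    exact min_le_right _ _
  rw [h3]
  calc _ ≤ |f₁ n x - g₁ x| * |f₂ n x - g₂ x| + |f₁ n x - g₁ x| * |g₂ x|
        + |g₁ x| * |f₂ n x - g₂ x| := by
        rw [← abs_mul, ← abs_mul, ← abs_mul]
        exact abs_add_three _ _ _
    _ ≤ e * 1 + e * B₂ + B₁ * e := by
        gcongr
        exacts [hn1 x, (hn2 x).trans (min_le_left _ _), hn1 x, hB₂ x, hB₁ x, hn2 x]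
    _ ≤ ε := by linarith

theorem TendstoUniformly.inv_of_le {f : ℕ → ℝ → ℝ} {g : ℝ → ℝ} {δ : ℝ} (hδ : 0 < δ)
    (h : TendstoUniformly f g atTop) (hf : ∀ n x, δ ≤ f n x) (hg : ∀ x, δ ≤ g x) :
    TendstoUniformly (fun n x => (f n x)⁻¹) (fun x => (g x)⁻¹) atTop := by
  rw [tendstoUniformly_iff_abs] at *
  intro ε hε
  filter_upwards [h (ε * (δ * δ)) (by positivity)] with n hn x
  have h1 := hδ.trans_le (hf n x)
  have h2 := hδ.trans_le (hg x)
  rw [inv_sub_inv h1.ne' h2.ne', abs_div, abs_of_pos (mul_pos h1 h2), div_le_iff₀ (by positivity),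
    abs_sub_comm]
  refine (hn x).trans ?_
  gcongr
  exacts [hf n x, hg x]

theorem TendstoUniformly.const_mul_left {f : ℕ → ℝ → ℝ} {g : ℝ → ℝ} (c : ℝ)
    (h : TendstoUniformly f g atTop) :
    TendstoUniformly (fun n x => c * f n x) (fun x => c * g x) atTop := by
  rw [tendstoUniformly_iff_abs] at *
  intro ε hε
  filter_upwards [h (ε / (|c| + 1)) (by positivity)] with n hn x
  rw [← mul_sub, abs_mul]
  calc |c| * |f n x - g x| ≤ (|c| + 1) * (ε / (|c| + 1)) := by
        gcongr
        exacts [by linarith, hn x]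
    _ = ε := by field_simp

theorem TendstoUniformly.tendsto_iSup_abs_sub {f : ℕ → ℝ → ℝ} {g : ℝ → ℝ}
    (h : TendstoUniformly f g atTop) :
    Tendsto (fun n => ⨆ x : ℝ, |g x - f n x|) atTop (𝓝 0) := by
  rw [tendstoUniformly_iff_abs] at h
  rw [Metric.tendsto_atTop']
  intro ε hε
  obtain ⟨N, hN⟩ := eventually_atTop.1 (h (ε / 2) (half_pos hε))
  refine ⟨N, fun n hn => ?_⟩
  rw [Real.dist_0_eq_abs, abs_of_nonneg (Real.iSup_nonneg fun x => abs_nonneg _)]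
  refine lt_of_le_of_lt (ciSup_le fun x => ?_) (half_lt_self hε)
  rw [abs_sub_comm]
  exact hN n hn.le x

theorem tendsto_c2Norm_sub {f : ℕ → ℝ → ℝ} {g : ℝ → ℝ} (hf : ∀ n, IsC2Torus (f n))
    (hg : IsC2Torus g) (h0 : TendstoUniformly f g atTop)
    (h1 : TendstoUniformly (fun n => deriv (f n)) (deriv g) atTop)
    (h2 : TendstoUniformly (fun n => deriv (deriv (f n))) (deriv (deriv g)) atTop) :
    Tendsto (fun n => c2Norm fun x => g x - f n x) atTop (𝓝 0) := by
  unfold c2Norm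
  have e1 (n : ℕ) := hg.deriv_sub (hf n)
  have e2 (n : ℕ) := hg.deriv_deriv_sub (hf n)
  simp only [e1] at e2
  simp only [e1, e2]
  simpa using (h0.tendsto_iSup_abs_sub.add h1.tendsto_iSup_abs_sub).add h2.tendsto_iSup_abs_sub

theorem tendstoUniformly_torusConv {K : ℕ → ℝ → ℝ} {K₀ : ℝ → ℝ} {f : ℕ → ℝ → ℝ} {f₀ : ℝ → ℝ}
    (hK : TendstoUniformly K K₀ atTop) (hf : TendstoUniformly f f₀ atTop)
    (hKc : ∀ n, Continuous (K n)) (hK₀ : Continuous K₀) (hp : Function.Periodic K₀ 1)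
    (hfc : ∀ n, Continuous (f n)) (hf₀ : Continuous f₀)
    (hpos : ∀ n x, 0 ≤ f n x) (hmass : ∀ n, ∫ x in (0 : ℝ)..1, f n x = 1) :
    TendstoUniformly (fun n => torusConv (K n) (f n)) (torusConv K₀ f₀) atTop := by
  obtain ⟨k, hk0, hk⟩ := exists_abs_le_of_periodic hK₀ hp
  rw [tendstoUniformly_iff_abs] at *
  intro ε hε
  filter_upwards [hK (ε / 2) (half_pos hε), hf (ε / (2 * (k + 1))) (by positivity)] with n hn1 hn2 x
  have hKn := hKc n
  have hfn := hfc n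
  have e1 : torusConv (K n) (f n) x - torusConv K₀ f₀ x =
      torusConv (fun x => K n x - K₀ x) (f n) x + torusConv K₀ (fun x => f n x - f₀ x) x := by
    rw [torusConv_sub_left hKn hK₀ hfn, torusConv_sub_right hK₀ hfn hf₀]
    ring
  have h1 := abs_torusConv_le_of_density (hKn.sub hK₀) hfn hn1 (hpos n) (hmass n) x
  have h2 := abs_torusConv_le hK₀ (hfn.sub hf₀) hk x
  have h3 : ∫ x in (0 : ℝ)..1, |f n x - f₀ x| ≤ ε / (2 * (k + 1)) := by
    have := intervalIntegral.integral_mono_on (μ := MeasureTheory.volume) zero_le_one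
      ((by fun_prop : Continuous fun x => |f n x - f₀ x|).intervalIntegrable 0 1)
      (by simp : IntervalIntegrable (fun _ => ε / (2 * (k + 1))) _ 0 1) fun x _ => hn2 x
    simpa using this
  have h4 : k * (ε / (2 * (k + 1))) ≤ ε / 2 := by
    calc k * (ε / (2 * (k + 1))) ≤ (k + 1) * (ε / (2 * (k + 1))) := by gcongr; linarith
      _ = ε / 2 := by field_simp
  rw [e1]
  calc _ ≤ _ := abs_add_le _ _
    _ ≤ ε / 2 + k * (ε / (2 * (k + 1))) :=
        add_le_add h1 (h2.trans (mul_le_mul_of_nonneg_left h3 hk0))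
    _ ≤ ε := by linarith

end Uniform

/-! ### Convergence of the approximations -/

section Convergence

variable {α j : ℝ}

/-- Writing the derivative through the density itself makes `m'` and `m''` sums of products of `m`,
`m'`, `u'`, `u''` and `u⁻¹`, so no convergence of powers has to be proved. -/
theorem hasDerivAt_congestionDensity (hj : j ≠ 0) {u : ℝ} (hu : 0 < u) :
    HasDerivAt (congestionDensity α j) (-(1 / α) * (congestionDensity α j u * u⁻¹)) u := by
  have hj2 : j ^ 2 ≠ 0 := by positivity
  have h1 : HasDerivAt (fun u => j ^ 2 / (2 * u)) (-(j ^ 2 / (2 * u)) * u⁻¹) u := by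
    have := ((hasDerivAt_id u).const_mul 2).fun_inv (by simpa using hu.ne') |>.const_mul (j ^ 2)
    refine this.congr_deriv ?_
    simp only [id]
    field_simp
  have h2 : j ^ 2 / (2 * u) ≠ 0 := by positivity
  have h3 := h1.rpow_const (p := 1 / α) (Or.inl h2)
  refine h3.congr_deriv ?_
  rw [Real.rpow_sub_one h2, congestionDensity]
  field_simp

theorem hasDerivAt_density {m u : ℝ → ℝ} (hj : j ≠ 0) (hu : Differentiable ℝ u)
    (hpos : ∀ x, 0 < u x) (hm : ∀ x, m x = congestionDensity α j (u x)) (x : ℝ) :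
    HasDerivAt m (-(1 / α) * (m x * deriv u x * (u x)⁻¹)) x := by
  have h1 := (hasDerivAt_congestionDensity (α := α) hj (hpos x)).comp x (hu x).hasDerivAt
  have h2 : m = congestionDensity α j ∘ u := funext hm
  rw [← h2] at h1
  refine h1.congr_deriv ?_
  rw [hm]
  ring

theorem deriv_density {m u : ℝ → ℝ} (hj : j ≠ 0) (hu : Differentiable ℝ u)
    (hpos : ∀ x, 0 < u x) (hm : ∀ x, m x = congestionDensity α j (u x)) :
    deriv m = fun x => -(1 / α) * (m x * deriv u x * (u x)⁻¹) :=
  funext fun x => (hasDerivAt_density hj hu hpos hm x).deriv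

theorem deriv_deriv_density {m u : ℝ → ℝ} (hj : j ≠ 0) (hu : IsC2Torus u)
    (hpos : ∀ x, 0 < u x) (hm : ∀ x, m x = congestionDensity α j (u x)) :
    deriv (deriv m) = fun x => -(1 / α) * (deriv m x * deriv u x * (u x)⁻¹
      + m x * deriv (deriv u) x * (u x)⁻¹
      + -1 * (m x * deriv u x * (deriv u x * (u x)⁻¹ * (u x)⁻¹))) := by
  ext x
  rw [deriv_density hj hu.differentiable hpos hm]
  have h1 := hasDerivAt_density hj hu.differentiable hpos hm x
  have h2 := (hu.differentiable_deriv x).hasDerivAt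
  have h3 := (hu.differentiable x).hasDerivAt.fun_inv (hpos x).ne'
  rw [(((h1.fun_mul h2).fun_mul h3).const_mul (-(1 / α))).deriv]
  have := (hpos x).ne'
  field_simp

theorem tendsto_solutions (hα : 0 < α) (hα2 : α ≤ 2) (hj : j ≠ 0) {V G m : ℝ → ℝ} {H : ℝ}
    {Gn mn : ℕ → ℝ → ℝ} {Hn : ℕ → ℝ} {K : ℝ} (hV : IsC2Torus V) (hG : IsC2Torus G)
    (hGn : ∀ n, IsC2Torus (Gn n)) (hmon : IsMonotoneKernel G)
    (hK : ∀ x, |deriv (deriv G) x| ≤ K) (hKn : ∀ n x, |deriv (deriv (Gn n)) x| ≤ K)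
    (h0 : TendstoUniformly Gn G atTop)
    (h1 : TendstoUniformly (fun n => deriv (Gn n)) (deriv G) atTop)
    (h2 : TendstoUniformly (fun n => deriv (deriv (Gn n))) (deriv (deriv G)) atTop)
    (hm : IsSolution α j V G m H) (hmn : ∀ n, IsSolution α j V (Gn n) (mn n) (Hn n)) :
    Tendsto (fun n => c2Norm fun x => m x - mn n x) atTop (𝓝 0) ∧
      Tendsto (fun n => H - Hn n) atTop (𝓝 0) := by
  obtain ⟨KV, hKV0, hKV⟩ := hV.exists_abs_deriv_deriv_le
  obtain ⟨δ, hδ, hap⟩ := exists_lt_of_isSolution hα hα2 hj hKV0 ((abs_nonneg _).trans (hK 0))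
  obtain ⟨hmu, hu, hmM⟩ := hap V G m H hV hG hKV hK hm
  have hapn (n : ℕ) := hap V (Gn n) (mn n) (Hn n) hV (hGn n) hKV (hKn n) (hmn n)
  obtain ⟨g, hg0, hg⟩ := exists_abs_le_of_periodic hG.continuous hG.periodic
  obtain ⟨C, hC0, hC⟩ := exists_stability_const hα hj hg0 (congestionDensity_pos (α := α) hj hδ)
  have hmc := hm.smooth.continuous
  have hmnc (n : ℕ) := (hmn n).smooth.continuous
  have hGc := hG.continuous
  have hGnc (n : ℕ) := (hGn n).continuous
  have hVc := hV.continuous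
  -- `mn n` is viewed as a solution for the fixed kernel `G` with potential `V - (Gn n - G) * mn n`,
  -- which differs from `V` by at most `d` since `mn n` is a density.
  have hstab (d : ℝ) (n : ℕ) (hd : ∀ x, |Gn n x - G x| ≤ d) :
      (∀ x, |mn n x - m x| ≤ C * d) ∧ |Hn n - H| ≤ C * d := by
    have hcc := continuous_torusConv ((hGnc n).sub hGc) (hmnc n)
    refine hC G (mn n) m (fun x => V x - torusConv (fun x => Gn n x - G x) (mn n) x) V (Hn n) H d
      hGc hmon hg (hmnc n) hmc (hmn n).smooth.periodic hm.smooth.periodic (hmn n).pos hm.pos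
      (hapn n).2.2 hmM (hmn n).mass hm.mass (hVc.sub hcc) hVc ?_ ?_ hm.eqn
    · intro x
      rw [sub_sub_cancel_left, abs_neg]
      exact abs_torusConv_le_of_density ((hGnc n).sub hGc) (hmnc n) hd
        (fun x => ((hmn n).pos x).le) (hmn n).mass x
    · intro x
      have : j ^ 2 / (2 * mn n x ^ α) + V x = torusConv (Gn n) (mn n) x + Hn n := (hmn n).eqn x
      rw [torusConv_sub_left (hGnc n) hGc (hmnc n)]
      linarith
  have hsmall (ε : ℝ) (hε : 0 < ε) :
      ∀ᶠ n in atTop, (∀ x, |mn n x - m x| ≤ ε) ∧ |Hn n - H| ≤ ε := by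
    filter_upwards [tendstoUniformly_iff_abs.1 h0 (ε / (C + 1)) (by positivity)] with n hn
    have hle : C * (ε / (C + 1)) ≤ ε := by
      calc C * (ε / (C + 1)) ≤ (C + 1) * (ε / (C + 1)) := by gcongr; linarith
        _ = ε := by field_simp
    obtain ⟨a, b⟩ := hstab _ n hn
    exact ⟨fun x => (a x).trans hle, b.trans hle⟩
  have hmt : TendstoUniformly mn m atTop := tendstoUniformly_iff_abs.2 fun ε hε =>
    (hsmall ε hε).mono fun n hn => hn.1
  have hHt : TendstoUniformly (fun n (_ : ℝ) => Hn n) (fun _ => H) atTop :=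
    tendstoUniformly_iff_abs.2 fun ε hε => (hsmall ε hε).mono fun n hn _ => hn.2
  have hHt' : Tendsto Hn atTop (𝓝 H) := hHt.tendsto_at 0
  refine ⟨?_, by simpa using hHt'.const_sub H⟩
  have hVt (f : ℝ → ℝ) : TendstoUniformly (fun (_ : ℕ) => f) f atTop :=
    tendstoUniformly_iff_abs.2 fun ε hε => Eventually.of_forall fun n x => by simpa using hε.le
  have hpn (n : ℕ) (x : ℝ) : 0 ≤ mn n x := ((hmn n).pos x).le
  have hmassn (n : ℕ) := (hmn n).mass
  set u : ℝ → ℝ := fun x => H - (V x - torusConv G m x) with hu_def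
  set un : ℕ → ℝ → ℝ := fun n x => Hn n - (V x - torusConv (Gn n) (mn n) x) with hun_def
  have hconst (c : ℝ) : IsC2Torus fun _ => c := ⟨contDiff_const, fun _ => rfl⟩
  have huC : IsC2Torus u := (hconst H).sub (hV.sub (hG.torusConv hmc))
  have hunC (n : ℕ) : IsC2Torus (un n) :=
    (hconst (Hn n)).sub (hV.sub ((hGn n).torusConv (hmnc n)))
  have hdu : deriv u = fun x => -(deriv V x - torusConv (deriv G) m x) := by
    rw [(hconst H).deriv_sub (hV.sub (hG.torusConv hmc)), hV.deriv_sub (hG.torusConv hmc),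
      hG.deriv_torusConv hmc]
    simp
  have hdun (n : ℕ) : deriv (un n) = fun x => -(deriv V x - torusConv (deriv (Gn n)) (mn n) x) := by
    rw [(hconst _).deriv_sub (hV.sub ((hGn n).torusConv (hmnc n))),
      hV.deriv_sub ((hGn n).torusConv (hmnc n)), (hGn n).deriv_torusConv (hmnc n)]
    simp
  have hddu : deriv (deriv u) =
      fun x => -(deriv (deriv V) x - torusConv (deriv (deriv G)) m x) := by
    rw [(hconst H).deriv_deriv_sub (hV.sub (hG.torusConv hmc)),
      hV.deriv_deriv_sub (hG.torusConv hmc), hG.deriv_deriv_torusConv hmc]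
    simp
  have hddun (n : ℕ) : deriv (deriv (un n)) =
      fun x => -(deriv (deriv V) x - torusConv (deriv (deriv (Gn n))) (mn n) x) := by
    rw [(hconst _).deriv_deriv_sub (hV.sub ((hGn n).torusConv (hmnc n))),
      hV.deriv_deriv_sub ((hGn n).torusConv (hmnc n)), (hGn n).deriv_deriv_torusConv (hmnc n)]
    simp
  have hu0 : TendstoUniformly un u atTop :=
    hHt.sub ((hVt V).sub (tendstoUniformly_torusConv h0 hmt hGnc hGc hG.periodic hmnc hmc hpn
      hmassn))
  have hu1 : TendstoUniformly (fun n => deriv (un n)) (deriv u) atTop := by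
    simp only [hdu, hdun]
    exact ((hVt _).sub (tendstoUniformly_torusConv h1 hmt (fun n => (hGn n).continuous_deriv)
      hG.continuous_deriv (periodic_deriv hG.periodic) hmnc hmc hpn hmassn)).neg
  have hu2 : TendstoUniformly (fun n => deriv (deriv (un n))) (deriv (deriv u)) atTop := by
    simp only [hddu, hddun]
    exact ((hVt _).sub (tendstoUniformly_torusConv h2 hmt
      (fun n => (hGn n).continuous_deriv_deriv) hG.continuous_deriv_deriv
      (periodic_deriv (periodic_deriv hG.periodic)) hmnc hmc hpn hmassn)).neg
  have hun (n : ℕ) := (hapn n).2.1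
  -- The lower bound `δ`, common to all `n`, is what lets the reciprocals converge uniformly.
  have hinv := hu0.inv_of_le hδ (fun n x => (hun n x).le) fun x => (hu x).le
  have hupos (x : ℝ) : 0 < u x := hδ.trans (hu x)
  have hunpos (n : ℕ) (x : ℝ) : 0 < un n x := hδ.trans (hun n x)
  have hdm := deriv_density hj huC.differentiable hupos hmu
  have hdmn (n : ℕ) := deriv_density hj (hunC n).differentiable (hunpos n) (hapn n).1
  have hddm := deriv_deriv_density hj huC hupos hmu
  have hddmn (n : ℕ) := deriv_deriv_density hj (hunC n) (hunpos n) (hapn n).1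
  obtain ⟨Bm, hBm0, hBm⟩ := exists_abs_le_of_periodic hmc hm.smooth.periodic
  obtain ⟨Bm', -, hBm'⟩ := exists_abs_le_of_periodic hm.smooth.continuous_deriv
    (periodic_deriv hm.smooth.periodic)
  obtain ⟨B1, hB10, hB1⟩ := exists_abs_le_of_periodic huC.continuous_deriv
    (periodic_deriv huC.periodic)
  obtain ⟨B2, -, hB2⟩ := huC.exists_abs_deriv_deriv_le
  have hBi (x : ℝ) : |(u x)⁻¹| ≤ δ⁻¹ := by
    rw [abs_of_pos (inv_pos.2 (hupos x))]
    exact inv_anti₀ hδ (hu x).le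
  have hbmul {f g : ℝ → ℝ} {a b : ℝ} (hf : ∀ x, |f x| ≤ a) (hg : ∀ x, |g x| ≤ b) (x : ℝ) :
      |f x * g x| ≤ a * b := by
    rw [abs_mul]
    exact mul_le_mul (hf x) (hg x) (abs_nonneg _) ((abs_nonneg _).trans (hf x))
  have hm1 : TendstoUniformly (fun n => deriv (mn n)) (deriv m) atTop := by
    simp only [hdm, hdmn]
    exact ((hmt.mul_of_bounded hu1 hBm hB1).mul_of_bounded hinv (hbmul hBm hB1)
      hBi).const_mul_left _
  refine tendsto_c2Norm_sub (fun n => (hmn n).smooth) hm.smooth hmt hm1 ?_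
  simp only [hddm, hddmn]
  refine TendstoUniformly.const_mul_left _ ((TendstoUniformly.add ?_ ?_).add
    (TendstoUniformly.const_mul_left _ ?_))
  · exact (hm1.mul_of_bounded hu1 hBm' hB1).mul_of_bounded hinv (hbmul hBm' hB1) hBi
  · exact (hmt.mul_of_bounded hu2 hBm hB2).mul_of_bounded hinv (hbmul hBm hB2) hBi
  · exact (hmt.mul_of_bounded hu1 hBm hB1).mul_of_bounded
      ((hu1.mul_of_bounded hinv hB1 hBi).mul_of_bounded hinv (hbmul hB1 hBi) hBi)
      (hbmul hBm hB1) (hbmul (hbmul hB1 hBi) hBi)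

end Convergence

/-! ### The main theorem. -/

theorem theorem1p4 (α j : ℝ) (hα : 0 < α) (hα2 : α ≤ 2) (hj : j ≠ 0)
    (V G : ℝ → ℝ) (hV : IsC2Torus V) (hG : IsC2Torus G)
    (hmon : IsMonotoneKernel G) (hweight : HasPositiveWeight G) :
    ∃ Gn : ℕ → ℝ → ℝ,
      (∀ n, Gn n = cesaroMean G n) ∧
      (∀ n, IsTrigPolynomial (Gn n)) ∧
      (∀ n, IsMonotoneKernel (Gn n) ∧ HasPositiveWeight (Gn n)) ∧
      Tendsto (fun n => c2Norm (fun x => G x - Gn n x)) atTop (𝓝 0) ∧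
      ∃ (mn : ℕ → ℝ → ℝ) (Hn : ℕ → ℝ),
        (∀ n, IsUniqueSolution α j V (Gn n) (mn n) (Hn n)) ∧
        ∃ (m : ℝ → ℝ) (H : ℝ),
          IsC2Torus m ∧
          Tendsto (fun n => c2Norm (fun x => m x - mn n x)) atTop (𝓝 0) ∧
          Tendsto (fun n => H - Hn n) atTop (𝓝 0) ∧
          IsUniqueSolution α j V G m H := by
  have heq (n : ℕ) := cesaroMean_eq_torusConv hG.continuous hG.periodic n
  have hFc := continuous_fejerKernel
  have hC2 (n : ℕ) : IsC2Torus (cesaroMean G n) := heq n ▸ hG.torusConv (hFc n)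
  have hp1 := periodic_deriv hG.periodic
  have hp2 := periodic_deriv hp1
  have h0 : TendstoUniformly (cesaroMean G) G atTop := by
    have := tendstoUniformly_torusConv_fejerKernel hG.continuous hG.periodic
    simpa only [← heq] using this
  have h1 : TendstoUniformly (fun n => deriv (cesaroMean G n)) (deriv G) atTop := by
    simp only [heq, hG.deriv_torusConv (hFc _)]
    exact tendstoUniformly_torusConv_fejerKernel hG.continuous_deriv hp1
  have h2 : TendstoUniformly (fun n => deriv (deriv (cesaroMean G n))) (deriv (deriv G)) atTop := by
    simp only [heq, hG.deriv_deriv_torusConv (hFc _)]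
    exact tendstoUniformly_torusConv_fejerKernel hG.continuous_deriv_deriv hp2
  have hmonn (n : ℕ) := hmon.cesaroMean hG.continuous hG.periodic n
  obtain ⟨K, -, hK⟩ := hG.exists_abs_deriv_deriv_le
  -- Averaging `G''` against the Fejér kernel, a probability density, cannot increase its sup norm;
  -- so one `K`, hence one `δ`, serves all `n`.
  have hKn (n : ℕ) (x : ℝ) : |deriv (deriv (cesaroMean G n)) x| ≤ K := by
    rw [heq, hG.deriv_deriv_torusConv (hFc n)]
    exact abs_torusConv_le_of_density hG.continuous_deriv_deriv (hFc n) hK (fejerKernel_nonneg n)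
      (integral_fejerKernel n) x
  choose mn Hn hsol using fun n => exists_isSolution hα hα2 hj hV (hC2 n) (hmonn n)
  obtain ⟨m, H, hm⟩ := exists_isSolution hα hα2 hj hV hG hmon
  obtain ⟨t1, t2⟩ := tendsto_solutions hα hα2 hj hV hG hC2 hmon hK hKn h0 h1 h2 hm hsol
  exact ⟨cesaroMean G, fun n => rfl, isTrigPolynomial_cesaroMean G,
    fun n => ⟨hmonn n, hasPositiveWeight_cesaroMean hweight n⟩,
    tendsto_c2Norm_sub hC2 hG h0 h1 h2, mn, Hn,
    fun n => (hsol n).isUniqueSolution hα hj hV (hC2 n) (hmonn n), m, H, hm.smooth, t1, t2,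
    hm.isUniqueSolution hα hj hV hG hmon⟩
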